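/- Let $\Lambda$ be a finite tree (the cell) with a distinguished vertex $\overline 0$ (the root) and boundary points $x_1,\dots,x_m\in\mathcal V_\Lambda$ (repetitions are allowed). Let $\Gamma$ be the rooted quasi-Cayley tree generated by $\Lambda$: its vertices are the pairs $(w,x)$ with $w$ a finite word over $\{1,\dots,m\}$ and $x\in\mathcal V_\Lambda$; each copy $\{w\}\times\Lambda$ carries the edges of $\Lambda$, and for every $w$ and $k$ an edge joins the boundary point $(w,x_k)$ to the root $(kw,\overline 0)$ of the copy indexed by $kw$. The root of $\Gamma$ is $(\emptyset,\overline 0)$. The AKLT model on $\Gamma$ has a spin $\deg(x)/2$ at each vertex $x$, and for a finite set $R$ of vertices the Hamiltonian $H_R=\sum_{\{x,y\}\subset R,\ x\sim y}P_{x,y}$, where $P_{x,y}$ is the orthogonal projection onto the subspace of maximal total spin $(\deg x+\deg y)/2$ of the pair $x,y$. Let $\Gamma_n$ be the ball of radius $n$ in the graph distance around the root of $\Gamma$. An infinite-volume ground state is a limit $\omega(A)=\lim_{n\to\infty}\operatorname{Tr}(\rho_nA)$ (existing for every local observable $A$), where each $\rho_n$ is a density matrix supported on $\ker H_{\Gamma_n}$;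 the ground state is unique if there is at most one such $\omega$. Let $\Lambda'$ be the augmentation of $\Lambda$, obtained by attaching to each $x_k$ a new vertex $v_k$ by a new edge, let $\mathcal G_1$ be the set of paths in $\Lambda'$ from $\overline 0$ to one of the $v_k$, and let $|\gamma|$ be the number of edges of $\gamma\in\mathcal G_1$ (equivalently, the number of vertices of $\Lambda$ on $\gamma$). If $$\sum_{\gamma\in\mathcal G_1}\left(\frac13\right)^{|\gamma|}>1,$$ then the AKLT model on $\Gamma$ does not have a unique ground state. -/

import Mathlib

/-! ### The AKLT model on a locally finite graph -/

namespace AKLT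

noncomputable section

open Filter Topology
open scoped Classical ComplexOrder

/-! #### Spin matrices

The spin-`d/2` representation of `su(2)` on `ℂ^{d+1}`; the basis vector with index `k : Fin (d+1)`
is the `S^z`-eigenvector with `k` "ups" among `d` spin-`1/2`s, of eigenvalue `k - d/2`. -/

/-- The spin matrix `S^z`. -/
def spinZ (d : ℕ) : Matrix (Fin (d + 1)) (Fin (d + 1)) ℂ :=
  Matrix.diagonal fun k => (k : ℂ) - (d : ℂ) / 2

/-- The raising operator `S^+ = S^x + i S^y`, `S^+ e_k = √((k+1)(d-k)) e_{k+1}`. -/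
def spinPlus (d : ℕ) : Matrix (Fin (d + 1)) (Fin (d + 1)) ℂ :=
  fun i j => if (i : ℕ) = (j : ℕ) + 1 then
    ((Real.sqrt (((j : ℝ) + 1) * ((d : ℝ) - (j : ℝ))) : ℝ) : ℂ) else 0

/-- The lowering operator `S^- = (S^+)^*`. -/
def spinMinus (d : ℕ) : Matrix (Fin (d + 1)) (Fin (d + 1)) ℂ :=
  (spinPlus d).conjTranspose

/-- The three spin matrices `S^x, S^y, S^z` of spin `d/2`. -/
def spin (d : ℕ) : Fin 3 → Matrix (Fin (d + 1)) (Fin (d + 1)) ℂ :=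
  ![(1 / 2 : ℂ) • (spinPlus d + spinMinus d),
    (-Complex.I / 2) • (spinPlus d - spinMinus d),
    spinZ d]

variable {W : Type*} (G : SimpleGraph W) [G.LocallyFinite]

/-- Basis configurations of a finite region `R`: the spin at `x` is `deg(x)/2`, where the degree is
taken in the whole graph. The Hilbert space `⨂_{x ∈ R} ℂ^{deg(x)+1}` of the region is
`EuclideanSpace ℂ (Config G R)`. -/
abbrev Config (R : Finset W) : Type _ := ∀ x : R, Fin (G.degree (x : W) + 1)

/-- The algebra of observables of the finite region `R`. -/
abbrev Obs (R : Finset W) : Type _ := Matrix (Config G R) (Config G R) ℂ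

variable {G}

/-- A one-site matrix acting at the site `x` of `R` and as the identity elsewhere. -/
def siteObs {R : Finset W} (x : R)
    (M : Matrix (Fin (G.degree (x : W) + 1)) (Fin (G.degree (x : W) + 1)) ℂ) : Obs G R :=
  fun σ τ => if ∀ z, z ≠ x → σ z = τ z then M (σ x) (τ x) else 0

/-- The embedding `A ↦ A ⊗ 1` of the observables of `R` into those of a larger region `S`. -/
def extendObs {R S : Finset W} (h : R ⊆ S) (A : Obs G R) : Obs G S :=
  fun σ τ => if ∀ z : S, (z : W) ∉ R → σ z = τ z
    then A (fun x => σ ⟨x, h x.2⟩) (fun x => τ ⟨x, h x.2⟩) else 0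

variable (G)

/-- The square `∑_α (S^α_x + S^α_y)²` of the total spin of the sites `x` and `y`. -/
def pairCasimir (R : Finset W) (x y : R) : Obs G R :=
  ∑ α : Fin 3, (siteObs x (spin (G.degree (x : W)) α) + siteObs y (spin (G.degree (y : W)) α)) ^ 2

/-- The largest total spin `J = (deg x + deg y)/2` of the pair `x, y`. -/
def maxSpin {R : Finset W} (x y : R) : ℂ :=
  ((G.degree (x : W) : ℂ) + (G.degree (y : W) : ℂ)) / 2

/-- The AKLT interaction of `x` and `y`: the orthogonal projection onto the subspace of total spin
`J = (deg x + deg y)/2`, i.e. onto the eigenspace of the squared total spin for `J(J+1)`. -/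
def pairProjection (R : Finset W) (x y : R) : Obs G R :=
  (Matrix.toEuclideanCLM (n := Config G R) (𝕜 := ℂ)).symm
    (Module.End.eigenspace
      (Matrix.toEuclideanCLM (n := Config G R) (𝕜 := ℂ) (pairCasimir G R x y)).toLinearMap
      (maxSpin G x y * (maxSpin G x y + 1))).starProjection

theorem pairProjection_symm (R : Finset W) (x y : R) :
    pairProjection G R x y = pairProjection G R y x := by
  have h₁ : pairCasimir G R x y = pairCasimir G R y x := by
    simp only [pairCasimir, add_comm]
  have h₂ : maxSpin G x y = maxSpin G y x := by
    simp only [maxSpin, add_comm]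
  simp only [pairProjection, h₁, h₂]

/-- The AKLT Hamiltonian of the finite region `R`: the sum of the interactions over all edges of
the graph with both ends in `R`. -/
def hamiltonian (R : Finset W) : Obs G R :=
  ∑ e ∈ (G.comap (Subtype.val : R → W)).edgeFinset,
    Sym2.lift ⟨pairProjection G R, pairProjection_symm G R⟩ e

/-- The finite-volume ground states of `R` (for all boundary conditions), as density matrices: those
supported on the kernel of the Hamiltonian. -/
structure IsGroundState (R : Finset W) (ρ : Obs G R) : Prop where
  posSemidef : ρ.PosSemidef
  trace_eq_one : ρ.trace = 1
  hamiltonian_mul : hamiltonian G R * ρ = 0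

/-- The vertices at graph distance at most `n` from `o`. -/
def ball (o : W) : ℕ → Finset W
  | 0 => {o}
  | n + 1 => ball o n ∪ (ball o n).biUnion fun x => G.neighborFinset x

/-- The expectation `Tr(ρ (A ⊗ 1))` in a state `ρ` of the region `S` of an observable `A` of a
region `R ⊆ S` (and `0` if `R` is not contained in `S`). -/
def expectation {S : Finset W} (ρ : Obs G S) {R : Finset W} (A : Obs G R) : ℂ :=
  if h : R ⊆ S then (ρ * extendObs h A).trace else 0

/-- `ω`, given by its values on the local observables (which determine a state of the quasi-local
algebra), is an infinite-volume ground state: for some sequence of ground states on the balls around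
`o`, one has `ω(A) = lim_n ω_n(A)` for every local observable `A`. -/
def IsInfiniteVolumeGroundState (o : W) (ω : ∀ R : Finset W, Obs G R → ℂ) : Prop :=
  ∃ ρ : ∀ n : ℕ, Obs G (ball G o n),
    (∀ n, IsGroundState G (ball G o n) (ρ n)) ∧
    ∀ (R : Finset W) (A : Obs G R),
      Tendsto (fun n => expectation G (ρ n) A) atTop (𝓝 (ω R A))

/-- The infinite-volume ground state does not depend on the choice of the finite-volume ground
states of which it is the limit. -/
def HasUniqueGroundState (o : W) : Prop :=
  ∀ ω₁ ω₂ : ∀ R : Finset W, Obs G R → ℂ,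
    IsInfiniteVolumeGroundState G o ω₁ → IsInfiniteVolumeGroundState G o ω₂ → ω₁ = ω₂

end

end AKLT

/-! ### Quasi-Cayley trees -/

namespace QuasiCayley

variable {V ι : Type*}

/-- The tree-like graph generated by the cell `Λ` with root `r` and boundary points `b k`, `k : ι`.
The copies of the cell are indexed by the words in `ι`, the nodes of the rooted tree in which every
node has one child for each boundary point; an edge joins the boundary point `b k` of the copy `w`
to the root of the copy `k :: w`. If `b` is injective, the boundary is a subset of the cell; for
constant `b` on a one-point cell the graph is the rooted Cayley tree. -/
def graph (Λ : SimpleGraph V) (r : V) (b : ι → V) : SimpleGraph (List ι × V) where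
  Adj p q :=
    (p.1 = q.1 ∧ Λ.Adj p.2 q.2) ∨
    (∃ k, q.1 = k :: p.1 ∧ p.2 = b k ∧ q.2 = r) ∨
    (∃ k, p.1 = k :: q.1 ∧ q.2 = b k ∧ p.2 = r)
  symm := ⟨by
    rintro p q (⟨h, h'⟩ | h | h)
    · exact Or.inl ⟨h.symm, h'.symm⟩
    · exact Or.inr (Or.inr h)
    · exact Or.inr (Or.inl h)⟩
  loopless := ⟨by
    rintro p (⟨-, h⟩ | ⟨k, h, -⟩ | ⟨k, h, -⟩)
    · exact Λ.loopless.irrefl _ h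
    · exact absurd (congrArg List.length h) (by simp)
    · exact absurd (congrArg List.length h) (by simp)⟩

theorem finite_neighborSet [Finite V] [Finite ι] (Λ : SimpleGraph V) (r : V) (b : ι → V)
    (p : List ι × V) : ((graph Λ r b).neighborSet p).Finite := by
  have h : (graph Λ r b).neighborSet p ⊆
      (({p.1} : Set (List ι)) ∪ Set.range (fun k => k :: p.1) ∪ {p.1.tail}) ×ˢ Set.univ := by
    rintro q (⟨h, -⟩ | ⟨k, h, -⟩ | ⟨k, h, -⟩)
    · exact ⟨Or.inl (Or.inl h.symm), trivial⟩
    · exact ⟨Or.inl (Or.inr ⟨k, h.symm⟩), trivial⟩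
    · exact ⟨Or.inr (by simp [h]), trivial⟩
  exact Set.Finite.subset
    ((((Set.finite_singleton _).union (Set.finite_range _)).union
      (Set.finite_singleton _)).prod Set.finite_univ) h

noncomputable instance [Finite V] [Finite ι] (Λ : SimpleGraph V) (r : V) (b : ι → V) :
    (graph Λ r b).LocallyFinite :=
  fun p => (finite_neighborSet Λ r b p).fintype

/-- The augmentation of the cell: a new vertex `v_k = inr k` is attached to each boundary point
`b k` by a new edge. -/
def augmentation (Λ : SimpleGraph V) (b : ι → V) : SimpleGraph (V ⊕ ι) where
  Adj
    | .inl x, .inl y => Λ.Adj x y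
    | .inl x, .inr k => x = b k
    | .inr k, .inl x => x = b k
    | .inr _, .inr _ => False
  symm := ⟨by
    rintro (x | k) (y | l) h
    · exact Λ.symm.symm _ _ h
    · exact h
    · exact h
    · exact h⟩
  loopless := ⟨by
    rintro (x | k) h
    · exact Λ.loopless.irrefl _ h
    · exact h⟩

/-- The sum of `(1/3)^{|γ|}` over all paths `γ` in the augmentation from the root of the cell to one
of the new vertices `v_k`. Here `|γ|` is the number of edges of `γ`; it is the number of vertices of
the cell itself on `γ`. -/
noncomputable def pathSum [Fintype ι] (Λ : SimpleGraph V) (r : V) (b : ι → V) : ℝ :=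
  ∑ k : ι, ∑ᶠ γ : (augmentation Λ b).Path (Sum.inl r) (Sum.inr k),
    (1 / 3 : ℝ) ^ (γ : (augmentation Λ b).Walk (Sum.inl r) (Sum.inr k)).length

end QuasiCayley

/-!
Realise the spin at `x` on the homogeneous polynomials of degree `deg x` in `u_x, v_x`. The
projection `P_{x,y}` annihilates every multiple of the singlet `u_x v_y - v_x u_y`, so a product
of singlets over the inner edges of a region and of one variable `u` or `v` for each edge leaving
it is a ground state. Mix these states by choosing the boundary variables independently, with
magnetisations `m`. Tracing out a vertex `c` whose children lie outside the region yields a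
mixture of the same kind, with a magnetisation at `c` which is `-Φ` of those at its children. A
solution of `m x = -Φ(m)` on the whole tree therefore defines an infinite-volume ground state, and
so does `-m`; the two differ as soon as the root spin has a nonzero expectation.

Writing `m x = (-1)^{dep x} μ x`, it remains to solve `μ x = Φ(μ)`. On a quasi-Cayley tree one may
take `μ` equal on all copies of the cell; this asks for a fixed point of the map `F` which takes a
common value `t` at the new vertices of the augmented cell to the resulting value at its root. The
linear part of `Φ` at `0` is a third of the sum over the children, so `F'(0)` is the sum of
`(1/3)^{|γ|}` over the paths `γ`. If it is larger than `1`, then `F(t) > t` for small `t > 0`,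
while `F(1) ≤ 1`, and the intermediate value theorem yields a positive fixed point.
-/

namespace AKLT

noncomputable section

open Filter Topology
open scoped Classical ComplexOrder Matrix

/-! ### Spin operators and the interaction -/

section Operators

variable {d : ℕ}

/-- The matrix `e_k ↦ c k • e_{k+1}` on `ℂ^{d+1}`; raising and creation operators have this form. -/
def weightedShift (d : ℕ) (c : ℕ → ℝ) : Matrix (Fin (d + 1)) (Fin (d + 1)) ℂ :=
  fun i j => if (i : ℕ) = (j : ℕ) + 1 then (c j : ℂ) else 0

theorem weightedShift_mul_conjTranspose {c a : ℕ → ℝ} (h₀ : a 0 = 0)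
    (h : ∀ k < d, c k ^ 2 = a (k + 1)) :
    weightedShift d c * (weightedShift d c)ᴴ =
      Matrix.diagonal fun k : Fin (d + 1) => (a k : ℂ) := by
  ext i j
  simp only [Matrix.mul_apply, Matrix.conjTranspose_apply, weightedShift, Matrix.diagonal_apply]
  obtain ⟨_ | i, hi⟩ := i
  · simp [h₀]
  · rw [Fintype.sum_eq_single ⟨i, by omega⟩ fun k hk => by
      rw [if_neg fun h => hk (Fin.ext (by simpa using h.symm)), zero_mul]]
    have hi' := h i (by omega)
    by_cases hij : j = ⟨i + 1, hi⟩
    · simp [hij, ← hi', sq]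
    · have hij' : (j : ℕ) ≠ i + 1 := fun h => hij (Fin.ext h)
      simp [Ne.symm hij, hij']

theorem conjTranspose_weightedShift_mul {c a : ℕ → ℝ} (h₀ : a d = 0)
    (h : ∀ k < d, c k ^ 2 = a k) :
    (weightedShift d c)ᴴ * weightedShift d c =
      Matrix.diagonal fun k : Fin (d + 1) => (a k : ℂ) := by
  ext i j
  simp only [Matrix.mul_apply, Matrix.conjTranspose_apply, weightedShift, Matrix.diagonal_apply]
  rcases (Fin.is_le i).lt_or_eq with hi | hi
  · rw [Fintype.sum_eq_single ⟨i + 1, by omega⟩ fun k hk => by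
      rw [if_neg fun h => hk (Fin.ext h), star_zero, zero_mul]]
    by_cases hij : i = j
    · simp [← hij, ← h i hi, sq]
    · rw [if_neg hij]
      simp [Fin.val_ne_of_ne hij]
  · have (k : Fin (d + 1)) : (k : ℕ) ≠ d + 1 := by omega
    simp [this, hi, h₀]

/-- Multiplication by `u` from the homogeneous polynomials of degree `d - 1` in `u, v` to those of
degree `d`, in the orthonormal bases of normalised monomials. Both bases are indexed by the exponent
of `u`, and the index `d`, which is absent from the source, is sent to `0`. -/
def createUp (d : ℕ) : Matrix (Fin (d + 1)) (Fin (d + 1)) ℂ :=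
  weightedShift d fun k => √(k + 1)

/-- Multiplication by `v`, with the conventions of `createUp`. -/
def createDown (d : ℕ) : Matrix (Fin (d + 1)) (Fin (d + 1)) ℂ :=
  Matrix.diagonal fun k => (√((d : ℝ) - k) : ℂ)

theorem conjTranspose_createDown (d : ℕ) : (createDown d)ᴴ = createDown d := by
  simp [createDown, Matrix.diagonal_conjTranspose, Pi.star_def]

theorem createUp_mul_conjTranspose (d : ℕ) :
    createUp d * (createUp d)ᴴ = spinZ d + (d / 2 : ℂ) • 1 := by
  rw [createUp, weightedShift_mul_conjTranspose (a := fun k => k) (by simp) fun k _ => by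
    rw [Real.sq_sqrt (by positivity)]; simp]
  simp [spinZ, Matrix.smul_one_eq_diagonal]

theorem createDown_mul_conjTranspose (d : ℕ) :
    createDown d * (createDown d)ᴴ = (d / 2 : ℂ) • 1 - spinZ d := by
  have hk (k : Fin (d + 1)) : (0 : ℝ) ≤ d - (k : ℕ) := sub_nonneg.2 (mod_cast k.is_le)
  rw [conjTranspose_createDown, createDown, spinZ, Matrix.smul_one_eq_diagonal,
    Matrix.diagonal_mul_diagonal, Matrix.diagonal_sub]
  congr! 2 with k
  rw [← Complex.ofReal_mul, Real.mul_self_sqrt (hk k)]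
  push_cast
  ring

theorem createUp_mul_conjTranspose_createDown (d : ℕ) :
    createUp d * (createDown d)ᴴ = spinPlus d := by
  ext i j
  rw [conjTranspose_createDown, createDown, Matrix.mul_diagonal, createUp, weightedShift, spinPlus]
  rw [ite_mul, zero_mul, ← Complex.ofReal_mul, ← Real.sqrt_mul (by positivity)]

theorem createDown_mul_conjTranspose_createUp (d : ℕ) :
    createDown d * (createUp d)ᴴ = spinMinus d := by
  rw [spinMinus, ← createUp_mul_conjTranspose_createDown, Matrix.conjTranspose_mul,
    Matrix.conjTranspose_conjTranspose]

theorem spinPlus_eq_weightedShift (d : ℕ) :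
    spinPlus d = weightedShift d fun k => √((k + 1) * (d - k)) := rfl

theorem spin_casimir (d : ℕ) :
    (1 / 2 : ℂ) • (spinPlus d * spinMinus d + spinMinus d * spinPlus d) + spinZ d ^ 2 =
      (d / 2 * (d / 2 + 1) : ℂ) • 1 := by
  have hsq (k : ℕ) (hk : k < d) :
      √((k + 1 : ℝ) * (d - k)) ^ 2 = (k + 1 : ℝ) * (d - k) := by
    have : (k : ℝ) < d := mod_cast hk
    exact Real.sq_sqrt (mul_nonneg (by positivity) (by linarith))
  have hpm : spinPlus d * spinMinus d =
      Matrix.diagonal fun k : Fin (d + 1) => (((k : ℕ) * (d - (k : ℕ) + 1) : ℝ) : ℂ) := by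
    rw [spinMinus, spinPlus_eq_weightedShift]
    refine weightedShift_mul_conjTranspose (a := fun k => (k * (d - k + 1) : ℝ)) (by simp)
      fun k hk => ?_
    rw [hsq k hk]
    push_cast
    ring
  have hmp : spinMinus d * spinPlus d =
      Matrix.diagonal fun k : Fin (d + 1) => ((((k : ℕ) + 1) * (d - (k : ℕ)) : ℝ) : ℂ) := by
    rw [spinMinus, spinPlus_eq_weightedShift]
    exact conjTranspose_weightedShift_mul (a := fun k => ((k + 1) * (d - k) : ℝ)) (by simp) hsq
  rw [hpm, hmp, spinZ, Matrix.diagonal_pow, Matrix.diagonal_add, ← Matrix.diagonal_smul,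
    Matrix.diagonal_add, Matrix.smul_one_eq_diagonal]
  congr! 2 with k
  simp only [Pi.smul_apply, Pi.pow_apply, smul_eq_mul]
  push_cast
  ring

end Operators

section SiteObservables

variable {W : Type*} {G : SimpleGraph W} [G.LocallyFinite] {R : Finset W}

theorem sum_siteObs_mul (x : R)
    (M : Matrix (Fin (G.degree (x : W) + 1)) (Fin (G.degree (x : W) + 1)) ℂ)
    (σ : Config G R) (f : Config G R → ℂ) :
    ∑ τ, siteObs x M σ τ * f τ = ∑ j, M (σ x) j * f (Function.update σ x j) := by
  have hupdate (τ : Config G R) : (∀ z, z ≠ x → σ z = τ z) ↔ Function.update σ x (τ x) = τ := by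
    rw [Function.update_eq_iff]
    simp
  simp only [siteObs, ite_mul, zero_mul, hupdate]
  rw [← Finset.sum_filter]
  refine Finset.sum_bij' (fun τ _ => τ x) (fun j _ => Function.update σ x j) (by simp) (by simp)
    (fun τ hτ => (Finset.mem_filter.1 hτ).2) (by simp) fun τ hτ => ?_
  rw [(Finset.mem_filter.1 hτ).2]

theorem siteObs_mul (x : R)
    (M N : Matrix (Fin (G.degree (x : W) + 1)) (Fin (G.degree (x : W) + 1)) ℂ) :
    (siteObs x (M * N) : Obs G R) = siteObs x M * siteObs x N := by
  ext σ τ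
  have h (j) : (∀ z, z ≠ x → Function.update σ x j z = τ z) ↔ ∀ z, z ≠ x → σ z = τ z :=
    forall₂_congr fun z hz => by rw [Function.update_of_ne hz]
  rw [Matrix.mul_apply, sum_siteObs_mul]
  simp only [siteObs, h, Function.update_self]
  split_ifs <;> simp [Matrix.mul_apply]

/-- The embedding `M ↦ 1 ⊗ M ⊗ 1` of the algebra of the site `x` into the observables of `R`. -/
def siteHom (x : R) :
    Matrix (Fin (G.degree (x : W) + 1)) (Fin (G.degree (x : W) + 1)) ℂ →⋆ₐ[ℂ] Obs G R :=
  StarAlgHom.mk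
    (AlgHom.ofLinearMap
      { toFun := siteObs x
        map_add' := fun M N => by ext σ τ; simp only [siteObs, Matrix.add_apply]; split_ifs <;> simp
        map_smul' := fun c M => by
          ext σ τ; simp only [siteObs, Matrix.smul_apply]; split_ifs <;> simp }
      (by
        ext σ τ
        have : σ = τ ↔ (∀ z, z ≠ x → σ z = τ z) ∧ σ x = τ x := by
          rw [funext_iff]
          exact ⟨fun h => ⟨fun z _ => h z, h x⟩,
            fun h z => if hz : z = x then hz ▸ h.2 else h.1 z hz⟩
        simp [siteObs, Matrix.one_apply, this, ite_and])
      (siteObs_mul x))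
    fun M => by ext σ τ; simp [siteObs, Matrix.star_apply, eq_comm, apply_ite (star : ℂ → ℂ)]

theorem siteHom_apply (x : R)
    (M : Matrix (Fin (G.degree (x : W) + 1)) (Fin (G.degree (x : W) + 1)) ℂ) :
    (siteHom x M : Obs G R) = siteObs x M := rfl

theorem siteHom_mulVec (x : R)
    (M : Matrix (Fin (G.degree (x : W) + 1)) (Fin (G.degree (x : W) + 1)) ℂ)
    (f : Config G R → ℂ) (σ : Config G R) :
    (siteHom x M *ᵥ f) σ = ∑ j, M (σ x) j * f (Function.update σ x j) :=
  sum_siteObs_mul x M σ f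

theorem commute_siteHom {x y : R} (hxy : x ≠ y)
    (M : Matrix (Fin (G.degree (x : W) + 1)) (Fin (G.degree (x : W) + 1)) ℂ)
    (N : Matrix (Fin (G.degree (y : W) + 1)) (Fin (G.degree (y : W) + 1)) ℂ) :
    Commute (siteHom x M : Obs G R) (siteHom y N) := by
  refine Matrix.ext_iff_mulVec.2 fun f => funext fun σ => ?_
  simp only [← Matrix.mulVec_mulVec, siteHom_mulVec, Function.update_of_ne hxy,
    Function.update_of_ne hxy.symm, Function.update_comm hxy, Finset.mul_sum]
  rw [Finset.sum_comm]
  simp only [mul_left_comm]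

end SiteObservables

section Interaction

theorem sq_add_sq_eq_ladder {A : Type*} [Ring A] [Algebra ℂ A] (P M : A) :
    ((1 / 2 : ℂ) • (P + M)) ^ 2 + ((-Complex.I / 2) • (P - M)) ^ 2 =
      (1 / 2 : ℂ) • (P * M + M * P) := by
  have hI : (-Complex.I / 2) ^ 2 = -(1 / 4 : ℂ) := by
    rw [div_pow, neg_sq, Complex.I_sq]; norm_num
  rw [smul_pow, smul_pow, hI]
  simp only [sq, mul_add, add_mul, mul_sub, sub_mul]
  module

variable {W : Type*} {G : SimpleGraph W} [G.LocallyFinite] {R : Finset W}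

theorem pairCasimir_eq_ladder (x y : R) :
    pairCasimir G R x y =
      (1 / 2 : ℂ) • ((siteHom x (spinPlus _) + siteHom y (spinPlus _)) *
          (siteHom x (spinMinus _) + siteHom y (spinMinus _)) +
        (siteHom x (spinMinus _) + siteHom y (spinMinus _)) *
          (siteHom x (spinPlus _) + siteHom y (spinPlus _))) +
      (siteHom x (spinZ _) + siteHom y (spinZ _)) ^ 2 := by
  rw [← sq_add_sq_eq_ladder, add_add_add_comm (siteHom x _), add_sub_add_comm (siteHom x _)]
  simp only [pairCasimir, Fin.sum_univ_three, spin, Matrix.cons_val, ← siteHom_apply, map_smul,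
    map_add, map_sub, ← smul_add]

/-- Multiplication of polynomials by the singlet `u_x v_y - v_x u_y` of the sites `x` and `y`, with
the conventions of `createUp`. -/
def singletCreation (x y : R) : Obs G R :=
  siteHom x (createUp _) * siteHom y (createDown _) -
    siteHom x (createDown _) * siteHom y (createUp _)

theorem siteHom_mul_conjTranspose {x y : R} (hxy : x ≠ y)
    (A B : Matrix (Fin (G.degree (x : W) + 1)) (Fin (G.degree (x : W) + 1)) ℂ)
    (C D : Matrix (Fin (G.degree (y : W) + 1)) (Fin (G.degree (y : W) + 1)) ℂ) :
    siteHom x A * siteHom y C * (siteHom x B * siteHom y D : Obs G R)ᴴ =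
      siteHom x (A * Bᴴ) * siteHom y (C * Dᴴ) := by
  rw [← Matrix.star_eq_conjTranspose, star_mul, ← map_star, ← map_star,
    (commute_siteHom hxy.symm _ _).eq, (commute_siteHom hxy.symm _ _).mul_mul_mul_comm, ← map_mul,
    ← map_mul, Matrix.star_eq_conjTranspose, Matrix.star_eq_conjTranspose]

theorem singletCreation_mul_conjTranspose {x y : R} (hxy : x ≠ y) :
    singletCreation x y * (singletCreation x y : Obs G R)ᴴ =
      ((G.degree (x : W) * G.degree (y : W) / 2 : ℂ)) • 1 -
        (2 : ℂ) • (siteHom x (spinZ _) * siteHom y (spinZ _)) -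
        (siteHom x (spinPlus _) * siteHom y (spinMinus _) +
          siteHom x (spinMinus _) * siteHom y (spinPlus _)) := by
  simp only [singletCreation, Matrix.conjTranspose_sub, sub_mul, mul_sub,
    siteHom_mul_conjTranspose hxy, createUp_mul_conjTranspose, createDown_mul_conjTranspose,
    createUp_mul_conjTranspose_createDown, createDown_mul_conjTranspose_createUp, map_add, map_sub,
    map_smul, map_one, add_mul, mul_add, smul_mul_assoc, mul_smul_comm, one_mul, mul_one]
  module

theorem pairCasimir_eq_sub_singletCreation {x y : R} (hxy : x ≠ y) :
    pairCasimir G R x y = (maxSpin G x y * (maxSpin G x y + 1)) • (1 : Obs G R) -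
      singletCreation x y * (singletCreation x y)ᴴ := by
  have casimir (z : R) := congrArg (siteHom (G := G) z) (spin_casimir (G.degree (z : W)))
  simp only [map_add, map_smul, map_one, map_mul, map_pow] at casimir
  have hsum := congrArg₂ (· + ·) (casimir x) (casimir y)
  rw [pairCasimir_eq_ladder, singletCreation_mul_conjTranspose hxy, maxSpin]
  simp only [sq, mul_add, add_mul] at hsum ⊢
  rw [(commute_siteHom hxy.symm (spinPlus _) (spinMinus _)).eq,
    (commute_siteHom hxy.symm (spinMinus _) (spinPlus _)).eq,
    (commute_siteHom hxy.symm (spinZ _) (spinZ _)).eq]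
  rw [← sub_eq_zero] at hsum ⊢
  rw [← hsum]
  module

theorem pairProjection_mul_singletCreation {x y : R} (hxy : x ≠ y) :
    pairProjection G R x y * singletCreation x y = 0 := by
  set K : Obs G R := singletCreation x y
  refine Matrix.ext_iff_mulVec.2 fun f => ?_
  rw [Matrix.zero_mulVec, ← Matrix.mulVec_mulVec, ← WithLp.ofLp_toLp 2 (K *ᵥ f),
    ← Matrix.ofLp_toEuclideanCLM, pairProjection, StarAlgEquiv.apply_symm_apply,
    (Submodule.starProjection_apply_eq_zero_iff _).2, WithLp.ofLp_zero]
  refine (Submodule.mem_orthogonal _ _).2 fun u hu => ?_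
  have hu₀ : (K * Kᴴ) *ᵥ u.ofLp = 0 := by
    have hu' := congrArg WithLp.ofLp (Module.End.mem_eigenspace_iff.1 hu)
    rwa [ContinuousLinearMap.coe_coe, Matrix.ofLp_toEuclideanCLM,
      pairCasimir_eq_sub_singletCreation hxy, Matrix.sub_mulVec, Matrix.smul_mulVec,
      Matrix.one_mulVec, WithLp.ofLp_smul, sub_eq_self] at hu'
  have huK : star u.ofLp ᵥ* K = 0 := by
    rw [← star_star (star u.ofLp ᵥ* K), Matrix.star_vecMul, star_star,
      (Matrix.self_mul_conjTranspose_mulVec_eq_zero K u.ofLp).1 hu₀, star_zero]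
  rw [EuclideanSpace.inner_eq_star_dotProduct, dotProduct_comm, Matrix.dotProduct_mulVec, huK,
    zero_dotProduct]

end Interaction

/-! ### States given by polynomials -/

section PolynomialState

open MvPolynomial

variable {W : Type*} {G : SimpleGraph W} [G.LocallyFinite] {R : Finset W}

/-- The exponent of the monomial `∏ x, u_x ^ σ x` which corresponds to the configuration `σ`. -/
def configExponent (σ : Config G R) : W →₀ ℕ :=
  Finsupp.onFinset R (fun x => if h : x ∈ R then (σ ⟨x, h⟩ : ℕ) else 0) fun x hx => by
    by_contra h
    simp [h] at hx

theorem configExponent_coe (σ : Config G R) (x : R) : configExponent σ (x : W) = σ x := by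
  simp [configExponent]

theorem configExponent_of_notMem (σ : Config G R) {x : W} (hx : x ∉ R) :
    configExponent σ x = 0 := by
  simp [configExponent, hx]

/-- The squared norm of the monomial `u ^ k * v ^ (d - k)` in boson Fock space. -/
def monomialNormSq (d k : ℕ) : ℝ := k.factorial * (d - k).factorial

theorem monomialNormSq_pos (d k : ℕ) : 0 < monomialNormSq d k := by
  rw [monomialNormSq]
  positivity

theorem monomialNormSq_succ_succ (d k : ℕ) :
    monomialNormSq (d + 1) (k + 1) = (k + 1) * monomialNormSq d k := by
  rw [monomialNormSq, monomialNormSq, Nat.add_sub_add_right, Nat.factorial_succ]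
  push_cast
  ring

theorem monomialNormSq_succ_left {d k : ℕ} (hk : k ≤ d) :
    monomialNormSq (d + 1) k = (d + 1 - k) * monomialNormSq d k := by
  rw [monomialNormSq, monomialNormSq, Nat.succ_sub hk, Nat.factorial_succ]
  push_cast [Nat.cast_sub hk]
  ring

/-- The squared norm of the monomial which corresponds to the configuration `σ`. -/
def configWeight (σ : Config G R) : ℝ :=
  ∏ x : R, monomialNormSq (G.degree (x : W)) (σ x)

theorem configWeight_pos (σ : Config G R) : 0 < configWeight σ :=
  Finset.prod_pos fun _ _ => monomialNormSq_pos _ _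

/-- The configuration `σ` with the entry at `x` lowered by one (or left at `0`). -/
def lowerConfig (σ : Config G R) (x : R) : Config G R :=
  Function.update σ x ⟨(σ x : ℕ) - 1, by omega⟩

theorem lowerConfig_self (σ : Config G R) (x : R) : (lowerConfig σ x x : ℕ) = σ x - 1 := by
  simp [lowerConfig]

theorem lowerConfig_of_ne (σ : Config G R) {x y : R} (h : y ≠ x) : lowerConfig σ x y = σ y := by
  simp [lowerConfig, h]

theorem configExponent_lowerConfig (σ : Config G R) (x : R) :
    configExponent (lowerConfig σ x) = configExponent σ - Finsupp.single (x : W) 1 := by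
  ext z
  rw [Finsupp.tsub_apply]
  by_cases hz : z ∈ R
  · lift z to R using hz
    rw [configExponent_coe, configExponent_coe]
    rcases eq_or_ne z x with rfl | hzx
    · simp [lowerConfig_self]
    · simp [lowerConfig_of_ne σ hzx, hzx]
  · rw [configExponent_of_notMem _ hz, configExponent_of_notMem _ hz, zero_tsub]

theorem monomialNormSq_mul_sub_pred {d k : ℕ} (hk : k ≠ 0) (hkd : k ≤ d) :
    monomialNormSq d k * (d - (k - 1 : ℕ)) = monomialNormSq d (k - 1) * k := by
  obtain ⟨k, rfl⟩ := Nat.exists_eq_succ_of_ne_zero hk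
  obtain ⟨d, rfl⟩ := Nat.exists_eq_succ_of_ne_zero (show d ≠ 0 by omega)
  rw [Nat.succ_sub_one, monomialNormSq_succ_succ,
    monomialNormSq_succ_left (Nat.le_of_succ_le_succ hkd)]
  push_cast
  ring

theorem configWeight_lowerConfig (σ : Config G R) (x : R) (hx : (σ x : ℕ) ≠ 0) :
    configWeight σ * (G.degree (x : W) - (lowerConfig σ x x : ℕ)) =
      configWeight (lowerConfig σ x) * (σ x : ℕ) := by
  have hrest : ∏ z ∈ Finset.univ.erase x, monomialNormSq (G.degree (z : W)) (lowerConfig σ x z) =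
      ∏ z ∈ Finset.univ.erase x, monomialNormSq (G.degree (z : W)) (σ z) :=
    Finset.prod_congr rfl fun z hz => by rw [lowerConfig_of_ne _ (Finset.ne_of_mem_erase hz)]
  rw [configWeight, configWeight, ← Finset.mul_prod_erase _ _ (Finset.mem_univ x),
    ← Finset.mul_prod_erase _ _ (Finset.mem_univ x), hrest, lowerConfig_self]
  linear_combination (∏ z ∈ Finset.univ.erase x, monomialNormSq (G.degree (z : W)) (σ z)) *
    monomialNormSq_mul_sub_pred hx (σ x).is_le

/-- The coordinates of the polynomial `P` in the orthonormal basis of normalised monomials. The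
variables `v_x` are set to `1`: their exponents are determined by those of the `u_x`. -/
def polyAmplitude (R : Finset W) (P : MvPolynomial W ℝ) (σ : Config G R) : ℝ :=
  coeff (configExponent σ) P * √(configWeight σ)

theorem polyAmplitude_eq_zero_of_degreeOf_lt {P : MvPolynomial W ℝ} {σ : Config G R} {x : R}
    (h : degreeOf (x : W) P < σ x) : polyAmplitude R P σ = 0 := by
  rw [polyAmplitude, mul_eq_zero]
  left
  by_contra hne
  have := monomial_le_degreeOf (x : W) (mem_support_iff.2 hne)
  rw [configExponent_coe] at this
  omega

theorem polyAmplitude_X_mul (P : MvPolynomial W ℝ) (σ : Config G R) (x : R) :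
    polyAmplitude R (X (x : W) * P) σ =
      √(σ x : ℕ) / √(G.degree (x : W) - (lowerConfig σ x x : ℕ)) *
        polyAmplitude R P (lowerConfig σ x) := by
  have hsupp : (x : W) ∈ (configExponent σ).support ↔ (σ x : ℕ) ≠ 0 := by
    rw [Finsupp.mem_support_iff, configExponent_coe]
  rw [polyAmplitude, polyAmplitude, coeff_X_mul']
  by_cases hx : (σ x : ℕ) = 0
  · simp [hsupp, hx]
  have hpos : (0 : ℝ) < G.degree (x : W) - (lowerConfig σ x x : ℕ) := by
    rw [lowerConfig_self, sub_pos]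
    exact_mod_cast (show (σ x : ℕ) - 1 < G.degree (x : W) by omega)
  have hweight := congrArg Real.sqrt (configWeight_lowerConfig σ x hx)
  rw [Real.sqrt_mul (configWeight_pos _).le, Real.sqrt_mul (configWeight_pos _).le] at hweight
  rw [if_pos (hsupp.2 hx), configExponent_lowerConfig, div_mul_eq_mul_div,
    eq_div_iff (by positivity), mul_assoc, hweight]
  ring

theorem siteHom_createDown_mulVec (y : R) (f : Config G R → ℂ) (σ : Config G R) :
    (siteHom y (createDown _) *ᵥ f) σ = (√(G.degree (y : W) - (σ y : ℕ)) : ℂ) * f σ := by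
  rw [siteHom_mulVec, Fintype.sum_eq_single (σ y) fun j hj => by
    rw [createDown, Matrix.diagonal_apply_ne _ hj.symm, zero_mul]]
  simp [createDown]

theorem siteHom_createUp_mulVec (x : R) (f : Config G R → ℂ) (σ : Config G R) :
    (siteHom x (createUp _) *ᵥ f) σ = (√(σ x : ℕ) : ℂ) * f (lowerConfig σ x) := by
  simp only [siteHom_mulVec, createUp, weightedShift, lowerConfig]
  rcases Nat.eq_zero_or_pos (σ x : ℕ) with h | h
  · simp [h]
  · rw [Fintype.sum_eq_single ⟨(σ x : ℕ) - 1, by omega⟩ fun j hj => by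
      rw [if_neg fun h' => hj (Fin.ext (by simp [h'])), zero_mul]]
    simp only [← Nat.cast_add_one, Nat.sub_add_cancel h, if_true]

/-- The preimage under `singletCreation x y` of the polynomial state of `(X x - X y) * P`. -/
def singletPreimage (P : MvPolynomial W ℝ) (x y : R) (τ : Config G R) : ℝ :=
  polyAmplitude R P τ / (√(G.degree (x : W) - (τ x : ℕ)) * √(G.degree (y : W) - (τ y : ℕ)))

theorem polyAmplitude_X_mul_eq_singletPreimage {x y : R} (hxy : x ≠ y) {P : MvPolynomial W ℝ}
    (hy : degreeOf (y : W) P < G.degree (y : W)) (σ : Config G R) :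
    polyAmplitude R (X (x : W) * P) σ =
      √(σ x : ℕ) * (√(G.degree (y : W) - (σ y : ℕ)) * singletPreimage P x y (lowerConfig σ x)) := by
  rw [polyAmplitude_X_mul, singletPreimage, lowerConfig_of_ne _ hxy.symm]
  rcases (σ y).is_le.lt_or_eq with hlt | heq
  · have : (0 : ℝ) < G.degree (y : W) - (σ y : ℕ) := sub_pos.2 (mod_cast hlt)
    field_simp
  · rw [← heq, ← lowerConfig_of_ne σ hxy.symm] at hy
    simp [polyAmplitude_eq_zero_of_degreeOf_lt hy]

theorem singletCreation_mulVec_singletPreimage {x y : R} (hxy : x ≠ y) {P : MvPolynomial W ℝ}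
    (hx : degreeOf (x : W) P < G.degree (x : W)) (hy : degreeOf (y : W) P < G.degree (y : W)) :
    singletCreation x y *ᵥ (fun τ : Config G R => (singletPreimage P x y τ : ℂ)) =
      fun σ => (polyAmplitude R ((X (x : W) - X (y : W)) * P) σ : ℂ) := by
  ext σ
  have hcomm (τ : Config G R) : singletPreimage P x y τ = singletPreimage P y x τ := by
    rw [singletPreimage, singletPreimage, mul_comm (√(_ - ((τ x : ℕ) : ℝ)))]
  have hsub : polyAmplitude R ((X (x : W) - X (y : W)) * P) σ =
      polyAmplitude R (X (x : W) * P) σ - polyAmplitude R (X (y : W) * P) σ := by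
    simp [polyAmplitude, sub_mul]
  rw [hsub, polyAmplitude_X_mul_eq_singletPreimage hxy hy,
    polyAmplitude_X_mul_eq_singletPreimage hxy.symm hx, ← hcomm, singletCreation,
    (commute_siteHom hxy (createDown _) (createUp _)).eq, Matrix.sub_mulVec, Pi.sub_apply,
    ← Matrix.mulVec_mulVec, ← Matrix.mulVec_mulVec, siteHom_createUp_mulVec,
    siteHom_createUp_mulVec, siteHom_createDown_mulVec, siteHom_createDown_mulVec,
    lowerConfig_of_ne _ hxy, lowerConfig_of_ne _ hxy.symm]
  push_cast
  rfl

theorem pairProjection_mulVec_polyAmplitude {x y : R} (hxy : x ≠ y) {P : MvPolynomial W ℝ}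
    (hx : degreeOf (x : W) P < G.degree (x : W)) (hy : degreeOf (y : W) P < G.degree (y : W)) :
    pairProjection G R x y *ᵥ
      (fun σ => (polyAmplitude R ((X (x : W) - X (y : W)) * P) σ : ℂ)) = 0 := by
  rw [← singletCreation_mulVec_singletPreimage hxy hx hy, Matrix.mulVec_mulVec,
    pairProjection_mul_singletCreation hxy, Matrix.zero_mulVec]

end PolynomialState

/-! ### Rooted trees -/

section RootedTree

variable {W : Type*}

/-- The graph `G` is a tree with root `o`, parent map `par` and depth function `dep`; the value of
`par` at the root is irrelevant. -/
structure IsRootedTree (G : SimpleGraph W) (o : W) (par : W → W) (dep : W → ℕ) : Prop where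
  dep_root : dep o = 0
  dep_par : ∀ x, x ≠ o → dep x = dep (par x) + 1
  adj_iff : ∀ x y, G.Adj x y ↔ (x ≠ o ∧ par x = y) ∨ (y ≠ o ∧ par y = x)

/-- The children of the vertex `x`. -/
def children (G : SimpleGraph W) [G.LocallyFinite] (o : W) (par : W → W) (x : W) : Finset W :=
  (G.neighborFinset x).filter fun y => y ≠ o ∧ par y = x

/-- The edges which leave the finite set `R` downwards, each represented by its lower end. -/
def legs (G : SimpleGraph W) [G.LocallyFinite] (o : W) (par : W → W) (R : Finset W) : Finset W :=
  R.biUnion (children G o par) \ R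

/-- A finite set of vertices which contains the root and is closed under taking parents. -/
structure IsParentClosed (o : W) (par : W → W) (R : Finset W) : Prop where
  root_mem : o ∈ R
  par_mem : ∀ x ∈ R, x ≠ o → par x ∈ R

namespace IsRootedTree

variable {G : SimpleGraph W} {o : W} {par : W → W} {dep : W → ℕ}

theorem par_ne_self (h : IsRootedTree G o par dep) {x : W} (hx : x ≠ o) : par x ≠ x := by
  intro hpar
  have := h.dep_par x hx
  rw [hpar] at this
  omega

theorem eq_root_of_dep_eq_zero (h : IsRootedTree G o par dep) {x : W} (hx : dep x = 0) :
    x = o := by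
  by_contra hne
  have := h.dep_par x hne
  omega

theorem adj_par (h : IsRootedTree G o par dep) {x : W} (hx : x ≠ o) : G.Adj x (par x) :=
  (h.adj_iff _ _).2 (Or.inl ⟨hx, rfl⟩)

variable [G.LocallyFinite] {R : Finset W}

theorem mem_children (h : IsRootedTree G o par dep) {x y : W} :
    y ∈ children G o par x ↔ y ≠ o ∧ par y = x := by
  simp only [children, Finset.mem_filter, SimpleGraph.mem_neighborFinset, h.adj_iff]
  tauto

theorem mem_legs (h : IsRootedTree G o par dep) {c : W} :
    c ∈ legs G o par R ↔ c ∉ R ∧ c ≠ o ∧ par c ∈ R := by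
  simp only [legs, Finset.mem_sdiff, Finset.mem_biUnion, h.mem_children]
  grind

theorem notMem_children_self (h : IsRootedTree G o par dep) (x : W) :
    x ∉ children G o par x := fun hx =>
  h.par_ne_self (h.mem_children.1 hx).1 (h.mem_children.1 hx).2

theorem neighborFinset_eq_insert (h : IsRootedTree G o par dep) {x : W} (hx : x ≠ o) :
    G.neighborFinset x = insert (par x) (children G o par x) := by
  ext y
  rw [SimpleGraph.mem_neighborFinset, Finset.mem_insert, h.mem_children, h.adj_iff]
  grind

theorem neighborFinset_root (h : IsRootedTree G o par dep) :
    G.neighborFinset o = children G o par o := by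
  ext y
  simp [h.mem_children, h.adj_iff]

theorem degree_root (h : IsRootedTree G o par dep) :
    G.degree o = (children G o par o).card := by
  rw [← SimpleGraph.card_neighborFinset_eq_degree, h.neighborFinset_root]

theorem degree_of_ne_root (h : IsRootedTree G o par dep) {x : W} (hx : x ≠ o) :
    G.degree x = (children G o par x).card + 1 := by
  rw [← SimpleGraph.card_neighborFinset_eq_degree, h.neighborFinset_eq_insert hx,
    Finset.card_insert_of_notMem]
  intro hpar
  obtain ⟨hpo, hpp⟩ := h.mem_children.1 hpar
  have hdep := h.dep_par _ hpo
  rw [hpp, h.dep_par x hx] at hdep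
  omega

theorem card_filter_incident_le_degree (h : IsRootedTree G o par dep) {S : Finset W} (hS : o ∉ S)
    (x : W) : (S.filter fun e => par e = x ∨ e = x).card ≤ G.degree x := by
  have hne {e : W} (he : e ∈ S) : e ≠ o := fun heo => hS (heo ▸ he)
  by_cases hx : x = o
  · rw [hx, h.degree_root]
    refine Finset.card_le_card fun e he => h.mem_children.2 ?_
    have := hne (Finset.mem_filter.1 he).1
    grind
  · rw [h.degree_of_ne_root hx, ← Finset.card_insert_of_notMem (h.notMem_children_self x)]
    refine Finset.card_le_card fun e he => ?_
    have := hne (Finset.mem_filter.1 he).1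
    rw [Finset.mem_insert, h.mem_children]
    grind

theorem card_filter_incident_lt_degree (h : IsRootedTree G o par dep) {S : Finset W} (hS : o ∉ S)
    {c x : W} (hcS : c ∉ S) (hco : c ≠ o) (hx : par c = x ∨ c = x) :
    (S.filter fun e => par e = x ∨ e = x).card < G.degree x := by
  have hle := h.card_filter_incident_le_degree (S := insert c S)
    (by simp [hS, hco.symm]) x
  rwa [Finset.filter_insert, if_pos hx,
    Finset.card_insert_of_notMem fun hc => hcS (Finset.mem_filter.1 hc).1, Nat.succ_le_iff] at hle

theorem mem_ball (h : IsRootedTree G o par dep) (n : ℕ) (x : W) :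
    x ∈ ball G o n ↔ dep x ≤ n := by
  induction n generalizing x with
  | zero =>
    rw [ball, Finset.mem_singleton, Nat.le_zero]
    exact ⟨fun hx => hx ▸ h.dep_root, h.eq_root_of_dep_eq_zero⟩
  | succ n ih =>
    simp only [ball, Finset.mem_union, Finset.mem_biUnion, ih, SimpleGraph.mem_neighborFinset]
    constructor
    · rintro (hx | ⟨y, hy, hyx⟩)
      · omega
      · rcases (h.adj_iff _ _).1 hyx with ⟨hne, rfl⟩ | ⟨hne, rfl⟩ <;>
          have := h.dep_par _ hne <;> omega
    · intro hx
      by_cases hxo : x = o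
      · simp [hxo, h.dep_root]
      · have := h.dep_par _ hxo
        exact Or.inr ⟨par x, by omega, (h.adj_par hxo).symm⟩

theorem isParentClosed_ball (h : IsRootedTree G o par dep) (n : ℕ) :
    IsParentClosed o par (ball G o n) where
  root_mem := by rw [h.mem_ball, h.dep_root]; omega
  par_mem x hx hxo := by
    rw [h.mem_ball] at hx ⊢
    have := h.dep_par x hxo
    omega

theorem ball_succ_eq (h : IsRootedTree G o par dep) (n : ℕ) :
    ball G o (n + 1) = ball G o n ∪ legs G o par (ball G o n) := by
  ext x
  rw [Finset.mem_union, h.mem_legs, h.mem_ball, h.mem_ball, h.mem_ball]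
  by_cases hxo : x = o
  · simp [hxo, h.dep_root]
  · have := h.dep_par x hxo
    simp only [ne_eq, hxo, not_false_eq_true, true_and]
    omega

theorem isParentClosed_union (h : IsRootedTree G o par dep) (hR : IsParentClosed o par R)
    {T : Finset W} (hT : T ⊆ legs G o par R) : IsParentClosed o par (R ∪ T) where
  root_mem := Finset.mem_union_left _ hR.root_mem
  par_mem x hx hxo := by
    refine Finset.mem_union_left _ ?_
    rcases Finset.mem_union.1 hx with hx | hx
    · exact hR.par_mem x hx hxo
    · exact (h.mem_legs.1 (hT hx)).2.2

theorem legs_insert (h : IsRootedTree G o par dep) (hR : IsParentClosed o par R) {c : W}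
    (hc : c ∈ legs G o par R) :
    legs G o par (insert c R) = (legs G o par R).erase c ∪ children G o par c := by
  rw [h.mem_legs] at hc
  ext x
  have hself : x ≠ o → par x ≠ x := h.par_ne_self
  have hpar : x ∈ R → x ≠ o → par x ∈ R := hR.par_mem x
  rw [Finset.mem_union, Finset.mem_erase, h.mem_legs, h.mem_legs, h.mem_children]
  grind

theorem disjoint_legs_children (h : IsRootedTree G o par dep) {c : W}
    (hc : c ∈ legs G o par R) :
    Disjoint ((legs G o par R).erase c) (children G o par c) := by
  rw [Finset.disjoint_left]
  intro x hx hxc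
  rw [Finset.mem_erase, h.mem_legs] at hx
  exact (h.mem_legs.1 hc).1 ((h.mem_children.1 hxc).2 ▸ hx.2.2.2)

end IsRootedTree

end RootedTree

/-! ### Averages over independent spins -/

section SpinMean

variable {α M N : Type*} [AddCommGroup M] [Module ℝ M] [AddCommGroup N] [Module ℝ N]

/-- The probability that, among independent spins in `K` of magnetisations `m x`, exactly those in
`κ` point up. -/
def spinWeight (m : α → ℝ) (K κ : Finset α) : ℝ :=
  (∏ x ∈ κ, (1 + m x) / 2) * ∏ x ∈ K \ κ, (1 - m x) / 2

/-- The expectation of `f κ`, where `κ` is the set of up spins among independent spins in `K` of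
magnetisations `m x`. -/
def spinMean (m : α → ℝ) (K : Finset α) (f : Finset α → M) : M :=
  ∑ κ ∈ K.powerset, spinWeight m K κ • f κ

variable {m n : α → ℝ} {K : Finset α}

theorem spinWeight_nonneg (hm : ∀ x ∈ K, |m x| ≤ 1) {κ : Finset α} (hκ : κ ⊆ K) :
    0 ≤ spinWeight m K κ := by
  refine mul_nonneg (Finset.prod_nonneg fun x hx => ?_) (Finset.prod_nonneg fun x hx => ?_)
  · linarith [abs_le.1 (hm x (hκ hx))]
  · linarith [abs_le.1 (hm x (Finset.sdiff_subset hx))]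

theorem spinMean_empty (m : α → ℝ) (f : Finset α → M) : spinMean m ∅ f = f ∅ := by
  simp [spinMean, spinWeight]

theorem spinMean_insert (m : α → ℝ) {c : α} (hc : c ∉ K) (f : Finset α → M) :
    spinMean m (insert c K) f =
      ((1 + m c) / 2) • spinMean m K (fun κ => f (insert c κ)) +
        ((1 - m c) / 2) • spinMean m K f := by
  rw [spinMean, Finset.sum_powerset_insert hc, add_comm, spinMean, spinMean, Finset.smul_sum,
    Finset.smul_sum]
  congr 1 <;> refine Finset.sum_congr rfl fun κ hκ => ?_ <;>
    have hcκ : c ∉ κ := fun h => hc (Finset.mem_powerset.1 hκ h) <;> rw [smul_smul]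
  · rw [spinWeight, spinWeight, Finset.prod_insert hcκ, Finset.insert_sdiff_insert,
      Finset.sdiff_insert_of_notMem hc, mul_assoc]
  · rw [spinWeight, spinWeight, Finset.insert_sdiff_of_notMem _ hcκ,
      Finset.prod_insert fun h => hc (Finset.sdiff_subset h), mul_left_comm]

theorem spinMean_congr {f g : Finset α → M} (hm : ∀ x ∈ K, m x = n x)
    (hf : ∀ κ ⊆ K, f κ = g κ) : spinMean m K f = spinMean n K g := by
  refine Finset.sum_congr rfl fun κ hκ => ?_
  rw [Finset.mem_powerset] at hκ
  have hup : ∏ x ∈ κ, (1 + m x) / 2 = ∏ x ∈ κ, (1 + n x) / 2 :=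
    Finset.prod_congr rfl fun x hx => by rw [hm x (hκ hx)]
  have hdown : ∏ x ∈ K \ κ, (1 - m x) / 2 = ∏ x ∈ K \ κ, (1 - n x) / 2 :=
    Finset.prod_congr rfl fun x hx => by rw [hm x (Finset.sdiff_subset hx)]
  rw [hf κ hκ, spinWeight, spinWeight, hup, hdown]

theorem map_spinMean (L : M →ₗ[ℝ] N) (m : α → ℝ) (K : Finset α) (f : Finset α → M) :
    L (spinMean m K f) = spinMean m K fun κ => L (f κ) := by
  simp only [spinMean, map_sum, map_smul]

theorem spinMean_add (m : α → ℝ) (K : Finset α) (f g : Finset α → M) :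
    spinMean m K (fun κ => f κ + g κ) = spinMean m K f + spinMean m K g := by
  simp only [spinMean, smul_add, Finset.sum_add_distrib]

theorem spinMean_smul (m : α → ℝ) (K : Finset α) (a : ℝ) (f : Finset α → M) :
    spinMean m K (fun κ => a • f κ) = a • spinMean m K f := by
  simp only [spinMean, Finset.smul_sum, smul_comm a]

theorem spinMean_smul_const (m : α → ℝ) (K : Finset α) (a : Finset α → ℝ) (v : M) :
    spinMean m K (fun κ => a κ • v) = spinMean m K a • v := by
  simp only [spinMean, smul_smul, Finset.sum_smul, smul_eq_mul]

theorem spinMean_const (m : α → ℝ) (K : Finset α) (v : M) : spinMean m K (fun _ => v) = v := by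
  induction K using Finset.induction_on with
  | empty => exact spinMean_empty m _
  | insert c K hc ih =>
    rw [spinMean_insert m hc, ih, ← add_smul]
    convert one_smul ℝ v
    ring

theorem spinMean_union (m : α → ℝ) {A B : Finset α} (hAB : Disjoint A B) (f : Finset α → M) :
    spinMean m (A ∪ B) f = spinMean m A fun η => spinMean m B fun κ => f (η ∪ κ) := by
  induction A using Finset.induction_on generalizing f with
  | empty => simp [spinMean_empty]
  | insert c A hc ih =>
    rw [Finset.disjoint_insert_left] at hAB
    have hcAB : c ∉ A ∪ B := by simp [hc, hAB.1]
    rw [Finset.insert_union, spinMean_insert m hcAB, spinMean_insert m hc, ih hAB.2, ih hAB.2]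
    simp only [Finset.insert_union]

theorem spinMean_map {β : Type*} (m : β → ℝ) (K : Finset α) (e : α ↪ β) (f : Finset β → M) :
    spinMean m (K.map e) f = spinMean (m ∘ e) K fun κ => f (κ.map e) := by
  induction K using Finset.induction_on generalizing f with
  | empty => simp [spinMean_empty]
  | insert c K hc ih =>
    have hec : e c ∉ K.map e := by simpa using hc
    rw [Finset.map_insert, spinMean_insert m hec, spinMean_insert _ hc, ih, ih]
    simp only [Finset.map_insert, Function.comp_apply]

theorem spinMean_neg (m : α → ℝ) (K : Finset α) (f : Finset α → M) :
    spinMean (-m) K f = spinMean m K fun κ => f (K \ κ) := by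
  have hinvol {κ : Finset α} (hκ : κ ∈ K.powerset) : K \ (K \ κ) = κ :=
    Finset.sdiff_sdiff_eq_self (Finset.mem_powerset.1 hκ)
  refine Finset.sum_nbij' (K \ ·) (K \ ·) (by simp) (by simp) (fun _ => hinvol)
    (fun _ => hinvol) fun κ hκ => ?_
  rw [spinWeight, spinWeight, hinvol hκ, mul_comm]
  simp only [hinvol hκ, Pi.neg_apply, sub_neg_eq_add, ← sub_eq_add_neg]

theorem spinMean_mono {f g : Finset α → ℝ} (hm : ∀ x ∈ K, |m x| ≤ 1)
    (hfg : ∀ κ ⊆ K, f κ ≤ g κ) : spinMean m K f ≤ spinMean m K g :=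
  Finset.sum_le_sum fun κ hκ => mul_le_mul_of_nonneg_left (hfg κ (Finset.mem_powerset.1 hκ))
    (spinWeight_nonneg hm (Finset.mem_powerset.1 hκ))

theorem continuousOn_spinMean {T : Type*} [TopologicalSpace T] {m : T → α → ℝ} {s : Set T}
    (hm : ∀ x ∈ K, ContinuousOn (fun t => m t x) s) (f : Finset α → ℝ) :
    ContinuousOn (fun t => spinMean (m t) K f) s := by
  refine continuousOn_finsetSum _ fun κ hκ => ContinuousOn.mul (ContinuousOn.mul
    (continuousOn_finsetProd _ fun x hx => ?_) (continuousOn_finsetProd _ fun x hx => ?_))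
    continuousOn_const
  · exact (continuousOn_const.add (hm x (Finset.mem_powerset.1 hκ hx))).div_const 2
  · exact (continuousOn_const.sub (hm x (Finset.sdiff_subset hx))).div_const 2

-- Russo's formula.
theorem hasDerivAt_spinMean {m : ℝ → α → ℝ} {s : α → ℝ} {t₀ : ℝ}
    (hm : ∀ x ∈ K, HasDerivAt (fun t => m t x) (s x) t₀) (f : Finset α → ℝ) :
    HasDerivAt (fun t => spinMean (m t) K f)
      (∑ i ∈ K, s i / 2 * spinMean (m t₀) (K.erase i) fun κ => f (insert i κ) - f κ) t₀ := by
  have spinMean_sub (m : α → ℝ) (K : Finset α) (f g : Finset α → ℝ) :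
      spinMean m K (fun κ => f κ - g κ) = spinMean m K f - spinMean m K g := by
    simp only [spinMean, smul_sub, Finset.sum_sub_distrib]
  induction K using Finset.induction_on generalizing f with
  | empty => simpa [spinMean_empty] using hasDerivAt_const t₀ (f ∅)
  | insert c K hc ih =>
    have hmc := hm c (Finset.mem_insert_self c K)
    have ih := ih fun x hx => hm x (Finset.mem_insert_of_mem hx)
    simp only [spinMean_insert _ hc, smul_eq_mul]
    refine ((((hmc.const_add 1).div_const 2).fun_mul (ih fun κ => f (insert c κ))).fun_add
      (((hmc.const_sub 1).div_const 2).fun_mul (ih f))).congr_deriv ?_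
    have hrest : ∀ i ∈ K,
        s i / 2 * spinMean (m t₀) ((insert c K).erase i) (fun κ => f (insert i κ) - f κ) =
          (1 + m t₀ c) / 2 * (s i / 2 * spinMean (m t₀) (K.erase i) fun κ =>
            f (insert c (insert i κ)) - f (insert c κ)) +
          (1 - m t₀ c) / 2 * (s i / 2 * spinMean (m t₀) (K.erase i) fun κ =>
            f (insert i κ) - f κ) := by
      intro i hi
      have hic : i ≠ c := fun h => hc (h ▸ hi)
      rw [Finset.erase_insert_of_ne hic.symm,
        spinMean_insert _ fun h => hc (Finset.mem_of_mem_erase h), smul_eq_mul, smul_eq_mul]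
      simp only [Finset.insert_comm c i]
      ring
    rw [Finset.sum_insert hc, Finset.erase_insert hc, Finset.sum_congr rfl hrest,
      Finset.sum_add_distrib, ← Finset.mul_sum, ← Finset.mul_sum, spinMean_sub]
    ring

theorem spinMean_zero_monomialNormSq_mul (K : Finset α) (h : ℕ → ℝ) :
    spinMean 0 K (fun κ => monomialNormSq K.card κ.card * h κ.card) =
      (1 / 2) ^ K.card * K.card.factorial * ∑ j ∈ Finset.range (K.card + 1), h j := by
  have hweight : ∀ κ ∈ K.powerset, spinWeight 0 K κ = (1 / 2) ^ K.card := by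
    intro κ hκ
    simp only [spinWeight, Pi.zero_apply, add_zero, sub_zero, Finset.prod_const, ← pow_add]
    rw [add_comm, Finset.card_sdiff_add_card_eq_card (Finset.mem_powerset.1 hκ)]
  have hchoose : ∀ j ∈ Finset.range (K.card + 1),
      K.card.choose j • (monomialNormSq K.card j * h j) = K.card.factorial * h j := by
    intro j hj
    rw [nsmul_eq_mul, monomialNormSq, ← mul_assoc, ← mul_assoc,
      ← Nat.choose_mul_factorial_mul_factorial (Finset.mem_range_succ_iff.1 hj)]
    push_cast
    rfl
  rw [spinMean, Finset.sum_congr rfl fun κ hκ => by rw [hweight κ hκ], ← Finset.smul_sum,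
    Finset.sum_powerset_apply_card fun j => monomialNormSq K.card j * h j,
    Finset.sum_congr rfl hchoose, ← Finset.mul_sum, smul_eq_mul, mul_assoc]

end SpinMean

section LegResponse

variable {α : Type*} {m n : α → ℝ} {K : Finset α}

/-- The partition function of a vertex without parent whose legs form the set `K`, the leg `x` being
an independent spin `1/2` of magnetisation `m x`. -/
def legMass (m : α → ℝ) (K : Finset α) : ℝ :=
  spinMean m K fun κ => monomialNormSq K.card κ.card

/-- The unnormalised expectation of `2 S^z` at a vertex without parent whose legs form the set `K`,
the leg `x` being an independent spin `1/2` of magnetisation `m x`. -/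
def legMoment (m : α → ℝ) (K : Finset α) : ℝ :=
  spinMean m K fun κ => monomialNormSq K.card κ.card * (2 * κ.card - K.card)

/-- Up to its sign, the magnetisation which a vertex with the legs `K` transmits to its parent. -/
def legResponse (m : α → ℝ) (K : Finset α) : ℝ :=
  legMoment m K / ((K.card + 2) * legMass m K)

theorem legResponse_congr (h : ∀ x ∈ K, m x = n x) : legResponse m K = legResponse n K := by
  rw [legResponse, legResponse, legMass, legMoment, spinMean_congr h fun _ _ => rfl,
    spinMean_congr h fun _ _ => rfl]
  rfl

theorem legResponse_map {β : Type*} (m : β → ℝ) (K : Finset α) (e : α ↪ β) :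
    legResponse m (K.map e) = legResponse (m ∘ e) K := by
  simp only [legResponse, legMoment, legMass, spinMean_map, Finset.card_map]

theorem legMass_neg (m : α → ℝ) (K : Finset α) : legMass (-m) K = legMass m K := by
  rw [legMass, spinMean_neg]
  refine spinMean_congr (fun _ _ => rfl) fun κ hκ => ?_
  rw [Finset.card_sdiff_of_subset hκ, monomialNormSq, monomialNormSq,
    Nat.sub_sub_self (Finset.card_le_card hκ), mul_comm]

theorem legMoment_neg (m : α → ℝ) (K : Finset α) : legMoment (-m) K = -legMoment m K := by
  rw [legMoment, legMoment, spinMean_neg, spinMean, spinMean, ← Finset.sum_neg_distrib]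
  refine Finset.sum_congr rfl fun κ hκ => ?_
  rw [Finset.mem_powerset] at hκ
  rw [Finset.card_sdiff_of_subset hκ, monomialNormSq, monomialNormSq,
    Nat.sub_sub_self (Finset.card_le_card hκ), Nat.cast_sub (Finset.card_le_card hκ)]
  simp only [smul_eq_mul]
  ring

theorem legResponse_neg (m : α → ℝ) (K : Finset α) :
    legResponse (-m) K = -legResponse m K := by
  rw [legResponse, legResponse, legMass_neg, legMoment_neg, neg_div]

theorem legResponse_zero (K : Finset α) : legResponse 0 K = 0 := by
  have := legResponse_neg (0 : α → ℝ) K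
  rw [neg_zero] at this
  linarith

theorem one_le_legMass (hm : ∀ x ∈ K, |m x| ≤ 1) : 1 ≤ legMass m K := by
  rw [← spinMean_const m K (1 : ℝ)]
  refine spinMean_mono hm fun κ _ => ?_
  rw [monomialNormSq]
  exact_mod_cast Nat.mul_pos (Nat.factorial_pos _) (Nat.factorial_pos _)

theorem card_add_two_mul_legMass_pos (hm : ∀ x ∈ K, |m x| ≤ 1) :
    0 < (K.card + 2) * legMass m K :=
  mul_pos (by positivity) (zero_lt_one.trans_le (one_le_legMass hm))

theorem mul_legResponse (hm : ∀ x ∈ K, |m x| ≤ 1) :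
    (K.card + 2) * legMass m K * legResponse m K = legMoment m K :=
  mul_div_cancel₀ _ (card_add_two_mul_legMass_pos hm).ne'

-- The vertex has `K.card + 1` virtual spins: those of its legs and that of the edge to its parent.
theorem spinMean_monomialNormSq_down (hm : ∀ x ∈ K, |m x| ≤ 1) :
    spinMean m K (fun κ => monomialNormSq (K.card + 1) κ.card) =
      (K.card + 2) * legMass m K * ((1 - legResponse m K) / 2) := by
  have hlin : spinMean m K (fun κ => monomialNormSq (K.card + 1) κ.card) =
      ((K.card + 2) * legMass m K - legMoment m K) / 2 := by
    rw [legMass, legMoment, spinMean, spinMean, spinMean, Finset.mul_sum,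
      ← Finset.sum_sub_distrib, Finset.sum_div]
    refine Finset.sum_congr rfl fun κ hκ => ?_
    rw [monomialNormSq_succ_left (Finset.card_le_card (Finset.mem_powerset.1 hκ))]
    simp only [smul_eq_mul]
    ring
  rw [hlin, ← mul_legResponse hm]
  ring

theorem spinMean_monomialNormSq_up (hm : ∀ x ∈ K, |m x| ≤ 1) :
    spinMean m K (fun κ => monomialNormSq (K.card + 1) (κ.card + 1)) =
      (K.card + 2) * legMass m K * ((1 + legResponse m K) / 2) := by
  have hlin : spinMean m K (fun κ => monomialNormSq (K.card + 1) (κ.card + 1)) =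
      ((K.card + 2) * legMass m K + legMoment m K) / 2 := by
    rw [legMass, legMoment, spinMean, spinMean, spinMean, Finset.mul_sum,
      ← Finset.sum_add_distrib, Finset.sum_div]
    refine Finset.sum_congr rfl fun κ _ => ?_
    rw [monomialNormSq_succ_succ]
    simp only [smul_eq_mul]
    ring
  rw [hlin, ← mul_legResponse hm]
  ring

theorem abs_legResponse_le_one (hm : ∀ x ∈ K, |m x| ≤ 1) : |legResponse m K| ≤ 1 := by
  have hpos := card_add_two_mul_legMass_pos hm
  have hnonneg {f : Finset α → ℝ} (hf : ∀ κ ⊆ K, 0 ≤ f κ) : 0 ≤ spinMean m K f :=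
    (spinMean_const m K (0 : ℝ)).symm.trans_le (spinMean_mono hm hf)
  have hdown := hnonneg fun κ _ => (monomialNormSq_pos (K.card + 1) κ.card).le
  have hup := hnonneg fun κ _ => (monomialNormSq_pos (K.card + 1) (κ.card + 1)).le
  rw [spinMean_monomialNormSq_down hm] at hdown
  rw [spinMean_monomialNormSq_up hm] at hup
  rw [abs_le]
  constructor
  · linarith [nonneg_of_mul_nonneg_right hup hpos]
  · linarith [nonneg_of_mul_nonneg_right hdown hpos]

theorem continuousOn_legResponse {T : Type*} [TopologicalSpace T] {m : T → α → ℝ} {s : Set T}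
    (hm : ∀ x ∈ K, ContinuousOn (fun t => m t x) s) (hm_le : ∀ t ∈ s, ∀ x ∈ K, |m t x| ≤ 1) :
    ContinuousOn (fun t => legResponse (m t) K) s :=
  (continuousOn_spinMean hm _).div (continuousOn_const.mul (continuousOn_spinMean hm _))
    fun t ht => (card_add_two_mul_legMass_pos (hm_le t ht)).ne'

theorem legMass_zero (K : Finset α) :
    legMass 0 K = (1 / 2) ^ K.card * K.card.factorial * (K.card + 1) := by
  have := spinMean_zero_monomialNormSq_mul K fun _ => 1
  simpa [legMass] using this

theorem sum_range_leg_covariance (l : ℕ) :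
    ∑ j ∈ Finset.range (l + 1),
        (((j : ℝ) + 1) * (2 * j + 1 - l) - (l + 1 - j) * (2 * j - l - 1)) =
      (l + 1) * (l + 2) * (l + 3) / 3 := by
  have hpoly (n : ℕ) : ∑ j ∈ Finset.range n,
      (((j : ℝ) + 1) * (2 * j + 1 - l) - (l + 1 - j) * (2 * j - l - 1)) =
        2 * n * (n - 1) * (2 * n - 1) / 3 - 2 * l * n * (n - 1) + n * (l ^ 2 + l + 2) := by
    induction n with
    | zero => simp
    | succ n ih =>
      rw [Finset.sum_range_succ, ih]
      push_cast
      ring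
  rw [hpoly]
  push_cast
  ring

theorem spinMean_zero_leg_covariance {K : Finset α} {i : α} (hi : i ∈ K) :
    spinMean 0 (K.erase i) (fun κ =>
        monomialNormSq K.card (insert i κ).card * (2 * (insert i κ).card - K.card) -
          monomialNormSq K.card κ.card * (2 * κ.card - K.card)) =
      2 / 3 * (K.card + 2) * legMass 0 K := by
  obtain ⟨L, hiL, rfl⟩ : ∃ L : Finset α, i ∉ L ∧ insert i L = K :=
    ⟨K.erase i, Finset.notMem_erase i K, Finset.insert_erase hi⟩
  rw [Finset.erase_insert hiL, legMass_zero, Finset.card_insert_of_notMem hiL]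
  have hdiff : ∀ κ ⊆ L,
      monomialNormSq (L.card + 1) (insert i κ).card *
          (2 * (insert i κ).card - (L.card + 1 : ℕ)) -
        monomialNormSq (L.card + 1) κ.card * (2 * κ.card - (L.card + 1 : ℕ)) =
      monomialNormSq L.card κ.card * (((κ.card : ℝ) + 1) * (2 * κ.card + 1 - L.card) -
        (L.card + 1 - κ.card) * (2 * κ.card - L.card - 1)) := by
    intro κ hκ
    rw [Finset.card_insert_of_notMem fun h => hiL (hκ h), monomialNormSq_succ_succ,
      monomialNormSq_succ_left (Finset.card_le_card hκ)]
    push_cast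
    ring
  rw [spinMean_congr (fun _ _ => rfl) hdiff, spinMean_zero_monomialNormSq_mul L fun j =>
    ((j : ℝ) + 1) * (2 * j + 1 - L.card) - (L.card + 1 - j) * (2 * j - L.card - 1),
    sum_range_leg_covariance, Nat.factorial_succ]
  push_cast
  ring

theorem hasDerivAt_legResponse {m : ℝ → α → ℝ} {s : α → ℝ} {t₀ : ℝ}
    (hm : ∀ x ∈ K, HasDerivAt (fun t => m t x) (s x) t₀) (hm_zero : ∀ x ∈ K, m t₀ x = 0) :
    HasDerivAt (fun t => legResponse (m t) K) (1 / 3 * ∑ x ∈ K, s x) t₀ := by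
  have hmass_eq : legMass (m t₀) K = legMass 0 K := spinMean_congr hm_zero fun _ _ => rfl
  have hmoment_eq : legMoment (m t₀) K = 0 :=
    (spinMean_congr (n := 0) hm_zero fun _ _ => rfl).trans <| by
      rw [← legMoment, ← mul_legResponse (by simp), legResponse_zero, mul_zero]
  have hpos : 0 < (K.card + 2) * legMass 0 K := card_add_two_mul_legMass_pos (by simp)
  have hmoment : HasDerivAt (fun t => legMoment (m t) K)
      ((K.card + 2) * legMass 0 K * (1 / 3 * ∑ x ∈ K, s x)) t₀ := by
    refine (hasDerivAt_spinMean hm _).congr_deriv ?_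
    rw [Finset.mul_sum, Finset.mul_sum]
    refine Finset.sum_congr rfl fun i hi => ?_
    rw [spinMean_congr (n := 0) (fun x hx => hm_zero x (Finset.mem_of_mem_erase hx))
      fun _ _ => rfl, spinMean_zero_leg_covariance hi]
    ring
  have hmass : HasDerivAt (fun t => (K.card + 2) * legMass (m t) K) _ t₀ :=
    (hasDerivAt_spinMean hm _).const_mul _
  refine (hmoment.fun_div hmass (hmass_eq ▸ hpos.ne')).congr_deriv ?_
  rw [hmoment_eq, zero_mul, sub_zero, hmass_eq, mul_right_comm, ← sq,
    mul_div_cancel_left₀ _ (pow_ne_zero 2 hpos.ne')]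

end LegResponse

/-! ### Partial traces of valence bond states -/

section PolyState

open MvPolynomial

variable {W : Type*} {G : SimpleGraph W} [G.LocallyFinite] {R : Finset W}

/-- The unnormalised density matrix of the pure state of the region `R` given by the
polynomial `P`. -/
def polyState (R : Finset W) (P : MvPolynomial W ℝ) : Obs G R :=
  Matrix.vecMulVec (fun σ => (polyAmplitude R P σ : ℂ)) (star fun σ => (polyAmplitude R P σ : ℂ))

theorem polyState_apply (P : MvPolynomial W ℝ) (σ τ : Config G R) :
    polyState R P σ τ = ((polyAmplitude R P σ * polyAmplitude R P τ : ℝ) : ℂ) := by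
  simp [polyState, Matrix.vecMulVec_apply]

theorem posSemidef_polyState (P : MvPolynomial W ℝ) :
    (polyState R P : Obs G R).PosSemidef :=
  Matrix.posSemidef_vecMulVec_self_star _

/-- The vertex `c` as a site of `insert c R`. -/
abbrev newSite (c : W) (R : Finset W) : (insert c R : Finset W) :=
  ⟨c, Finset.mem_insert_self c R⟩

/-- The configuration of `insert c R` which is `σ` on `R` and takes the value `s` at `c`. -/
def glueConfig {c : W} (σ : Config G R) (s : Fin (G.degree c + 1)) : Config G (insert c R) :=
  Function.update (fun x => if hx : (x : W) ∈ R then σ ⟨x, hx⟩ else 0) (newSite c R) s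

theorem glueConfig_newSite {c : W} (σ : Config G R) (s : Fin (G.degree c + 1)) :
    glueConfig σ s (newSite c R) = s :=
  Function.update_self ..

theorem glueConfig_of_mem {c : W} (hc : c ∉ R) (σ : Config G R) (s : Fin (G.degree c + 1))
    {x : W} (hx : x ∈ R) : glueConfig σ s ⟨x, Finset.mem_insert_of_mem hx⟩ = σ ⟨x, hx⟩ := by
  have hne : (⟨x, Finset.mem_insert_of_mem hx⟩ : (insert c R : Finset W)) ≠ newSite c R :=
    ne_of_apply_ne Subtype.val (ne_of_mem_of_not_mem hx hc)
  rw [glueConfig, Function.update_of_ne hne, dif_pos hx]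

/-- The decomposition of the configurations of `insert c R` into their restriction to `R` and their
value at `c`. -/
def glueEquiv {c : W} (hc : c ∉ R) :
    Config G R × Fin (G.degree c + 1) ≃ Config G (insert c R) where
  toFun p := glueConfig p.1 p.2
  invFun σ := (fun x => σ ⟨x, Finset.mem_insert_of_mem x.2⟩, σ (newSite c R))
  left_inv p :=
    Prod.ext (funext fun x => glueConfig_of_mem hc p.1 p.2 x.2) (glueConfig_newSite p.1 p.2)
  right_inv σ := by
    ext1 ⟨x, hx⟩
    rcases Finset.mem_insert.1 hx with rfl | hxR
    · exact glueConfig_newSite _ _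
    · exact glueConfig_of_mem hc _ _ hxR

theorem configExponent_glueConfig {c : W} (hc : c ∉ R) (σ : Config G R)
    (s : Fin (G.degree c + 1)) :
    configExponent (glueConfig σ s) = configExponent σ + Finsupp.single c (s : ℕ) := by
  ext x
  rw [Finsupp.add_apply]
  by_cases hx : x ∈ R
  · have hxc : x ≠ c := ne_of_mem_of_not_mem hx hc
    rw [configExponent_coe _ ⟨x, Finset.mem_insert_of_mem hx⟩, configExponent_coe σ ⟨x, hx⟩,
      glueConfig_of_mem hc, Finsupp.single_eq_of_ne hxc, add_zero]
  · rw [configExponent_of_notMem σ hx, zero_add]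
    by_cases hxc : x = c
    · subst hxc
      rw [Finsupp.single_eq_same]
      exact (configExponent_coe _ (newSite x R)).trans (by rw [glueConfig_newSite])
    · rw [configExponent_of_notMem _ (by simp [hx, hxc]), Finsupp.single_eq_of_ne hxc]

theorem configWeight_eq_prod (σ : Config G R) :
    configWeight σ = ∏ x ∈ R, monomialNormSq (G.degree x) (configExponent σ x) := by
  rw [← Finset.prod_coe_sort, configWeight]
  simp only [configExponent_coe]

theorem configWeight_glueConfig {c : W} (hc : c ∉ R) (σ : Config G R)
    (s : Fin (G.degree c + 1)) :
    configWeight (glueConfig σ s) = configWeight σ * monomialNormSq (G.degree c) s := by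
  have hrest : ∀ x ∈ R, monomialNormSq (G.degree x) (configExponent (glueConfig σ s) x) =
      monomialNormSq (G.degree x) (configExponent σ x) := fun x hx => by
    have hxc : x ≠ c := ne_of_mem_of_not_mem hx hc
    rw [configExponent_glueConfig hc, Finsupp.add_apply, Finsupp.single_eq_of_ne hxc, add_zero]
  rw [configWeight_eq_prod, configWeight_eq_prod, Finset.prod_insert hc,
    Finset.prod_congr rfl hrest, configExponent_glueConfig hc, Finsupp.add_apply,
    configExponent_of_notMem σ hc, zero_add, Finsupp.single_eq_same, mul_comm]

theorem extendObs_glueConfig {S : Finset W} {c : W} (hc : c ∉ R) (hS : S ⊆ R)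
    (A : Obs G S) (σ τ : Config G R) (s t : Fin (G.degree c + 1)) :
    extendObs (hS.trans (Finset.subset_insert c R)) A (glueConfig σ s) (glueConfig τ t) =
      if s = t then extendObs hS A σ τ else 0 := by
  have hagree : (∀ z : (insert c R : Finset W), (z : W) ∉ S →
      glueConfig σ s z = glueConfig τ t z) ↔ s = t ∧ ∀ z : R, (z : W) ∉ S → σ z = τ z := by
    constructor
    · refine fun h => ⟨?_, fun z hz => ?_⟩
      · simpa only [glueConfig_newSite] using h (newSite c R) fun hcS => hc (hS hcS)
      · have hz' := h ⟨z, Finset.mem_insert_of_mem z.2⟩ hz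
        rwa [glueConfig_of_mem hc σ s z.2, glueConfig_of_mem hc τ t z.2] at hz'
    · rintro ⟨rfl, h⟩ ⟨z, hz⟩ hzS
      rcases Finset.mem_insert.1 hz with rfl | hzR
      · exact (glueConfig_newSite σ s).trans (glueConfig_newSite τ s).symm
      · rw [glueConfig_of_mem hc σ s hzR, glueConfig_of_mem hc τ s hzR]
        exact h _ hzS
  have hrestrict (ρ : Config G R) (r : Fin (G.degree c + 1)) :
      (fun x : S => glueConfig ρ r ⟨x, Finset.mem_insert_of_mem (hS x.2)⟩) =
        fun x : S => ρ ⟨x, hS x.2⟩ :=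
    funext fun x => glueConfig_of_mem hc ρ r (hS x.2)
  simp only [extendObs, hagree, hrestrict, ite_and]

/-- The partial trace over the site `c`. -/
def partialTrace (c : W) (R : Finset W) : Obs G (insert c R) →ₗ[ℝ] Obs G R where
  toFun ρ σ τ := ∑ s, ρ (glueConfig σ s) (glueConfig τ s)
  map_add' _ _ := Matrix.ext fun _ _ => Finset.sum_add_distrib
  map_smul' a _ := Matrix.ext fun _ _ => (Finset.smul_sum (r := a)).symm

theorem partialTrace_apply (c : W) (ρ : Obs G (insert c R)) (σ τ : Config G R) :
    partialTrace c R ρ σ τ = ∑ s, ρ (glueConfig σ s) (glueConfig τ s) :=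
  rfl

theorem trace_mul_extendObs_insert {S : Finset W} {c : W} (hc : c ∉ R) (hS : S ⊆ R)
    (A : Obs G S) (ρ : Obs G (insert c R)) :
    (ρ * extendObs (hS.trans (Finset.subset_insert c R)) A).trace =
      (partialTrace c R ρ * extendObs hS A).trace := by
  have hdiag (p : Config G R × Fin (G.degree c + 1)) :
      ∑ τ, ρ (glueEquiv hc p) τ *
          extendObs (hS.trans (Finset.subset_insert c R)) A τ (glueEquiv hc p) =
        ∑ τ, ρ (glueConfig p.1 p.2) (glueConfig τ p.2) * extendObs hS A τ p.1 := by
    rw [← (glueEquiv (G := G) hc).sum_comp, Fintype.sum_prod_type]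
    refine Finset.sum_congr rfl fun τ _ => ?_
    simp only [glueEquiv, Equiv.coe_fn_mk, extendObs_glueConfig hc hS, mul_ite, mul_zero,
      Finset.sum_ite_eq', Finset.mem_univ, if_true]
  simp only [Matrix.trace, Matrix.diag_apply, Matrix.mul_apply]
  rw [← (glueEquiv (G := G) hc).sum_comp, Finset.sum_congr rfl fun p _ => hdiag p,
    Fintype.sum_prod_type]
  refine Finset.sum_congr rfl fun σ _ => ?_
  rw [Finset.sum_comm]
  simp only [partialTrace_apply, Finset.sum_mul]

theorem coeff_add_single_X_pow_mul {c : W} {P : MvPolynomial W ℝ} (hP : degreeOf c P = 0)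
    {e : W →₀ ℕ} (he : e c = 0) (s j : ℕ) :
    coeff (e + Finsupp.single c s) (X c ^ j * P) = if s = j then coeff e P else 0 := by
  have hle : Finsupp.single c j ≤ e + Finsupp.single c s ↔ j ≤ s := by
    simp [Finsupp.single_le_iff, he]
  rw [X_pow_eq_monomial, coeff_monomial_mul', one_mul]
  simp only [hle]
  rcases lt_trichotomy s j with hlt | rfl | hgt
  · rw [if_neg (by omega), if_neg hlt.ne]
  · rw [if_pos le_rfl, if_pos rfl, add_tsub_cancel_right]
  · rw [if_pos hgt.le, if_neg hgt.ne']
    by_contra hne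
    have hcoeff := monomial_le_degreeOf c (mem_support_iff.2 hne)
    simp only [hP, Finsupp.tsub_apply, Finsupp.add_apply, he, Finsupp.single_eq_same] at hcoeff
    omega

theorem polyAmplitude_glueConfig_X_pow_mul {c : W} (hc : c ∉ R) {P : MvPolynomial W ℝ}
    (hP : degreeOf c P = 0) (σ : Config G R) (s : Fin (G.degree c + 1)) (j : ℕ) :
    polyAmplitude (insert c R) (X c ^ j * P) (glueConfig σ s) =
      if (s : ℕ) = j then √(monomialNormSq (G.degree c) j) * polyAmplitude R P σ else 0 := by
  rw [polyAmplitude, configExponent_glueConfig hc,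
    coeff_add_single_X_pow_mul hP (configExponent_of_notMem σ hc), configWeight_glueConfig hc]
  split_ifs with h
  · rw [Real.sqrt_mul (configWeight_pos σ).le, h, polyAmplitude]
    ring
  · rw [zero_mul]

-- The two terms have different numbers of up spins at `c`, so that the cross terms vanish.
theorem partialTrace_polyState {c : W} (hc : c ∉ R) {P Q : MvPolynomial W ℝ}
    (hP : degreeOf c P = 0) (hQ : degreeOf c Q = 0) {k : ℕ} (hk : k < G.degree c) :
    partialTrace c R (polyState (insert c R) (X c ^ k * P - X c ^ (k + 1) * Q) : Obs G _) =
      monomialNormSq (G.degree c) k • polyState R P +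
        monomialNormSq (G.degree c) (k + 1) • polyState R Q := by
  ext σ τ
  set a := monomialNormSq (G.degree c) k
  set b := monomialNormSq (G.degree c) (k + 1)
  have hsub (υ : Config G R) (s : Fin (G.degree c + 1)) :
      polyAmplitude (insert c R) (X c ^ k * P - X c ^ (k + 1) * Q) (glueConfig υ s) =
        (if s = ⟨k, by omega⟩ then √a * polyAmplitude R P υ else 0) -
          if s = ⟨k + 1, by omega⟩ then √b * polyAmplitude R Q υ else 0 := by
    simp only [Fin.ext_iff]
    rw [← polyAmplitude_glueConfig_X_pow_mul hc hP, ← polyAmplitude_glueConfig_X_pow_mul hc hQ,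
      polyAmplitude, coeff_sub, sub_mul]
    rfl
  have hterm (s : Fin (G.degree c + 1)) :
      polyState (insert c R) (X c ^ k * P - X c ^ (k + 1) * Q) (glueConfig σ s)
          (glueConfig τ s) =
        (if s = ⟨k, by omega⟩ then (a : ℂ) * polyState R P σ τ else 0) +
          if s = ⟨k + 1, by omega⟩ then (b : ℂ) * polyState R Q σ τ else 0 := by
    have ha_sq : √a * √a = a := Real.mul_self_sqrt (monomialNormSq_pos _ _).le
    have hb_sq : √b * √b = b := Real.mul_self_sqrt (monomialNormSq_pos _ _).le
    rw [polyState_apply, polyState_apply, polyState_apply, hsub, hsub]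
    split_ifs with h₁ h₂ h₂
    · simp [h₁] at h₂
    all_goals norm_cast
    · linear_combination polyAmplitude R P σ * polyAmplitude R P τ * ha_sq
    · linear_combination polyAmplitude R Q σ * polyAmplitude R Q τ * hb_sq
  rw [partialTrace_apply, Finset.sum_congr rfl fun s _ => hterm s, Finset.sum_add_distrib,
    Finset.sum_ite_eq', Finset.sum_ite_eq', if_pos (Finset.mem_univ _), if_pos (Finset.mem_univ _)]
  simp

end PolyState

section BondState

open MvPolynomial

variable {W : Type*} {G : SimpleGraph W} {o : W} {par : W → W} {dep : W → ℕ} {R : Finset W}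

/-- The valence bond polynomial with a singlet on each edge of `A` and an up spin at the upper end
of each edge of `η`, an edge being represented by its lower end. -/
def bondPoly (par : W → W) (A η : Finset W) : MvPolynomial W ℝ :=
  (∏ e ∈ A, (X (par e) - X e)) * ∏ e ∈ η, X (par e)

theorem degreeOf_bondPoly_le (par : W → W) {A η : Finset W} (hAη : Disjoint A η) (x : W) :
    degreeOf x (bondPoly par A η) ≤ ((A ∪ η).filter fun e => par e = x ∨ e = x).card := by
  rw [Finset.filter_union, Finset.card_union_of_disjoint (Finset.disjoint_filter_filter hAη),
    Finset.card_filter, Finset.card_filter]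
  refine (degreeOf_mul_le ..).trans (add_le_add
    ((degreeOf_prod_le ..).trans (Finset.sum_le_sum fun e _ => ?_))
    ((degreeOf_prod_le ..).trans (Finset.sum_le_sum fun e _ => ?_)))
  · refine (degreeOf_sub_le ..).trans ?_
    rw [degreeOf_X, degreeOf_X]
    grind
  · rw [degreeOf_X]
    grind

theorem bondPoly_eq_mul_erase (par : W → W) {A : Finset W} {e : W} (he : e ∈ A) (η : Finset W) :
    bondPoly par A η = (X (par e) - X e) * bondPoly par (A.erase e) η := by
  rw [bondPoly, bondPoly, ← Finset.mul_prod_erase _ _ he, mul_assoc]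

variable [G.LocallyFinite]

namespace IsRootedTree

theorem disjoint_legs (h : IsRootedTree G o par dep) {A η : Finset W} (hA : A ⊆ R)
    (hη : η ⊆ legs G o par R) : Disjoint A η :=
  Finset.disjoint_left.2 fun _ hxA hxη => (h.mem_legs.1 (hη hxη)).1 (hA hxA)

theorem pairProjection_mulVec_bondPoly (h : IsRootedTree G o par dep) {η : Finset W}
    (hη : η ⊆ legs G o par R) {x y : R} (hy : (y : W) ≠ o) (hxy : par y = x) :
    pairProjection G R x y *ᵥ
      (fun σ => (polyAmplitude R (bondPoly par (R.erase o) η) σ : ℂ)) = 0 := by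
  have hyR : (y : W) ∈ R.erase o := Finset.mem_erase.2 ⟨hy, y.2⟩
  have hdisj : Disjoint ((R.erase o).erase y) η :=
    h.disjoint_legs ((Finset.erase_subset ..).trans (Finset.erase_subset ..)) hη
  have hdegree {z : W} (hz : par y = z ∨ y = z) :
      degreeOf z (bondPoly par ((R.erase o).erase y) η) < G.degree z := by
    have hoη : o ∉ η := fun ho => (h.mem_legs.1 (hη ho)).2.1 rfl
    have hyη : (y : W) ∉ η := fun hyη => (h.mem_legs.1 (hη hyη)).1 y.2
    exact (degreeOf_bondPoly_le par hdisj z).trans_lt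
      (h.card_filter_incident_lt_degree (by simp [hoη]) (by simp [hyη]) hy hz)
  rw [bondPoly_eq_mul_erase par hyR, hxy]
  refine pairProjection_mulVec_polyAmplitude ?_ (hdegree (Or.inl hxy)) (hdegree (Or.inr rfl))
  rintro rfl
  exact h.par_ne_self hy hxy

theorem hamiltonian_mul_polyState_bondPoly (h : IsRootedTree G o par dep) {η : Finset W}
    (hη : η ⊆ legs G o par R) :
    hamiltonian G R * polyState R (bondPoly par (R.erase o) η) = 0 := by
  rw [hamiltonian, Finset.sum_mul]
  refine Finset.sum_eq_zero fun e he => ?_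
  rw [polyState, Matrix.mul_vecMulVec]
  suffices hs : Sym2.lift ⟨pairProjection G R, pairProjection_symm G R⟩ e *ᵥ
      (fun σ => (polyAmplitude R (bondPoly par (R.erase o) η) σ : ℂ)) = 0 by
    rw [hs, Matrix.zero_vecMulVec]
  induction e using Sym2.ind with
  | _ x y =>
    rw [SimpleGraph.mem_edgeFinset, SimpleGraph.mem_edgeSet, SimpleGraph.comap_adj,
      h.adj_iff] at he
    change pairProjection G R x y *ᵥ _ = 0
    rcases he with ⟨hx, hxy⟩ | ⟨hy, hyx⟩
    · rw [pairProjection_symm]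
      exact h.pairProjection_mulVec_bondPoly hη hx hxy
    · exact h.pairProjection_mulVec_bondPoly hη hy hyx

theorem degreeOf_bondPoly_eq_zero (h : IsRootedTree G o par dep) (hR : IsParentClosed o par R)
    {η : Finset W} (hη : η ⊆ legs G o par R) {c : W} (hc : c ∉ R) :
    degreeOf c (bondPoly par (R.erase o) η) = 0 := by
  have hX {x : W} (hx : x ∈ R) : degreeOf c (X x : MvPolynomial W ℝ) = 0 := by
    rw [degreeOf_X, if_neg (ne_of_mem_of_not_mem hx hc).symm]
  refine Nat.eq_zero_of_le_zero ((degreeOf_mul_le ..).trans (add_le_add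
    ((degreeOf_prod_le ..).trans_eq (Finset.sum_eq_zero fun e he => ?_))
    ((degreeOf_prod_le ..).trans_eq (Finset.sum_eq_zero fun e he => ?_))))
  · obtain ⟨heo, heR⟩ := Finset.mem_erase.1 he
    refine Nat.eq_zero_of_le_zero ((degreeOf_sub_le ..).trans ?_)
    rw [hX heR, hX (hR.par_mem e heR heo), max_self]
  · exact hX (h.mem_legs.1 (hη he)).2.2

theorem bondPoly_insert (h : IsRootedTree G o par dep) {c : W} (hc : c ∈ legs G o par R)
    {η κ : Finset W} (hη : η ⊆ (legs G o par R).erase c) (hκ : κ ⊆ children G o par c) :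
    bondPoly par ((insert c R).erase o) (η ∪ κ) =
      X c ^ κ.card * bondPoly par (R.erase o) (insert c η) -
        X c ^ (κ.card + 1) * bondPoly par (R.erase o) η := by
  obtain ⟨hcR, hco, -⟩ := h.mem_legs.1 hc
  have hκ_prod : ∏ e ∈ κ, (X (par e) : MvPolynomial W ℝ) = X c ^ κ.card :=
    Finset.prod_eq_pow_card fun e he => by rw [(h.mem_children.1 (hκ he)).2]
  rw [bondPoly, bondPoly, bondPoly, Finset.erase_insert_of_ne hco,
    Finset.prod_insert fun hcR' => hcR (Finset.mem_of_mem_erase hcR'),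
    Finset.prod_union ((h.disjoint_legs_children hc).mono hη hκ), hκ_prod,
    Finset.prod_insert fun hcη => Finset.ne_of_mem_erase (hη hcη) rfl]
  ring

end IsRootedTree

end BondState

section BondMixture

variable {W : Type*} {G : SimpleGraph W} [G.LocallyFinite] {o : W} {par : W → W} {dep : W → ℕ}
  {R : Finset W} {m : W → ℝ}

/-- The unnormalised mixture of valence bond states of `R` in which the virtual spins at the upper
ends of the edges leaving `R` are independent, with magnetisations `m`. -/
def bondMixture (G : SimpleGraph W) [G.LocallyFinite] (o : W) (par : W → W) (m : W → ℝ)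
    (R : Finset W) : Obs G R :=
  spinMean m (legs G o par R) fun η => polyState R (bondPoly par (R.erase o) η)

/-- The magnetisations `m x` of the virtual spins at the upper ends of the edges above the vertices
`x ≠ o` are those induced by the magnetisations further down, so that the corresponding mixtures of
valence bond states are consistent. -/
structure IsBoundaryLaw (G : SimpleGraph W) [G.LocallyFinite] (o : W) (par : W → W)
    (m : W → ℝ) : Prop where
  abs_le_one : ∀ x, |m x| ≤ 1
  eq_neg_legResponse : ∀ c, c ≠ o → m c = -legResponse m (children G o par c)

theorem IsBoundaryLaw.neg (hm : IsBoundaryLaw G o par m) : IsBoundaryLaw G o par (-m) where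
  abs_le_one x := (abs_neg (m x)).trans_le (hm.abs_le_one x)
  eq_neg_legResponse c hc := by
    rw [legResponse_neg, Pi.neg_apply, hm.eq_neg_legResponse c hc]

theorem posSemidef_bondMixture (hm : ∀ x, |m x| ≤ 1) : (bondMixture G o par m R).PosSemidef := by
  refine Matrix.posSemidef_sum _ fun η hη => (posSemidef_polyState _).smul ?_
  exact spinWeight_nonneg (fun x _ => hm x) (Finset.mem_powerset.1 hη)

namespace IsRootedTree

theorem hamiltonian_mul_bondMixture (h : IsRootedTree G o par dep) :
    hamiltonian G R * bondMixture G o par m R = 0 := by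
  rw [bondMixture, spinMean, Finset.mul_sum]
  refine Finset.sum_eq_zero fun η hη => ?_
  rw [mul_smul_comm, h.hamiltonian_mul_polyState_bondPoly (Finset.mem_powerset.1 hη), smul_zero]

theorem partialTrace_polyState_bondPoly (h : IsRootedTree G o par dep)
    (hR : IsParentClosed o par R) {c : W} (hc : c ∈ legs G o par R) {η κ : Finset W}
    (hη : η ⊆ (legs G o par R).erase c) (hκ : κ ⊆ children G o par c) :
    partialTrace c R (polyState (insert c R) (bondPoly par ((insert c R).erase o) (η ∪ κ)) :
        Obs G _) =
      monomialNormSq ((children G o par c).card + 1) κ.card •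
          polyState R (bondPoly par (R.erase o) (insert c η)) +
        monomialNormSq ((children G o par c).card + 1) (κ.card + 1) •
          polyState R (bondPoly par (R.erase o) η) := by
  obtain ⟨hcR, hco, -⟩ := h.mem_legs.1 hc
  have hdegree : G.degree c = (children G o par c).card + 1 := h.degree_of_ne_root hco
  have hη_legs : η ⊆ legs G o par R := hη.trans (Finset.erase_subset _ _)
  rw [h.bondPoly_insert hc hη hκ, ← hdegree]
  exact partialTrace_polyState hcR
    (h.degreeOf_bondPoly_eq_zero hR (Finset.insert_subset hc hη_legs) hcR)
    (h.degreeOf_bondPoly_eq_zero hR hη_legs hcR)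
    (hdegree ▸ Nat.lt_succ_of_le (Finset.card_le_card hκ))

theorem partialTrace_bondMixture (h : IsRootedTree G o par dep) (hR : IsParentClosed o par R)
    (hm : IsBoundaryLaw G o par m) {c : W} (hc : c ∈ legs G o par R) :
    partialTrace c R (bondMixture G o par m (insert c R)) =
      (((children G o par c).card + 2) * legMass m (children G o par c)) •
        bondMixture G o par m R := by
  set K := children G o par c
  set A := (legs G o par R).erase c
  set state : Finset W → Obs G R := fun η => polyState R (bondPoly par (R.erase o) η)
  have hmean : ∀ η ⊆ A, (spinMean m K fun κ => partialTrace c R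
      (polyState (insert c R) (bondPoly par ((insert c R).erase o) (η ∪ κ)))) =
        ((K.card + 2) * legMass m K) •
          (((1 + m c) / 2) • state (insert c η) + ((1 - m c) / 2) • state η) := fun η hη => by
    have hmK : ∀ x ∈ K, |m x| ≤ 1 := fun x _ => hm.abs_le_one x
    rw [spinMean_congr (fun _ _ => rfl)
        fun κ hκ => h.partialTrace_polyState_bondPoly hR hc hη hκ,
      spinMean_add, spinMean_smul_const, spinMean_smul_const, spinMean_monomialNormSq_down hmK,
      spinMean_monomialNormSq_up hmK, hm.eq_neg_legResponse c (h.mem_legs.1 hc).2.1, smul_add,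
      smul_smul, smul_smul, sub_neg_eq_add, ← sub_eq_add_neg]
  rw [bondMixture, map_spinMean, h.legs_insert hR hc,
    spinMean_union m (h.disjoint_legs_children hc), spinMean_congr (fun _ _ => rfl) hmean,
    spinMean_smul, spinMean_add, spinMean_smul, spinMean_smul,
    ← spinMean_insert m (Finset.notMem_erase c _), Finset.insert_erase hc, bondMixture]

end IsRootedTree

end BondMixture

/-! ### Infinite-volume ground states -/

section Reduction

variable {W : Type*} {G : SimpleGraph W} [G.LocallyFinite] {o : W} {R R' R'' : Finset W}

theorem extendObs_one {S : Finset W} (hS : S ⊆ R) : extendObs hS (1 : Obs G S) = 1 := by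
  ext σ τ
  have hiff : ((∀ z : R, (z : W) ∉ S → σ z = τ z) ∧
      (fun x : S => σ ⟨x, hS x.2⟩) = fun x : S => τ ⟨x, hS x.2⟩) ↔ σ = τ := by
    refine ⟨fun ⟨hout, hin⟩ => funext fun z => ?_, fun hστ => hστ ▸ ⟨fun _ _ => rfl, rfl⟩⟩
    by_cases hz : (z : W) ∈ S
    · exact congrFun hin ⟨z, hz⟩
    · exact hout z hz
  simp only [extendObs, Matrix.one_apply, ← ite_and, hiff]

theorem extendObs_refl (hR : R ⊆ R) (A : Obs G R) : extendObs hR A = A := by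
  ext σ τ
  simp [extendObs]

/-- Up to a positive factor, `ρ` is the reduced density matrix of `ρ'` on the region `R`. -/
def ReducesTo (ρ' : Obs G R') (ρ : Obs G R) : Prop :=
  R ⊆ R' ∧ ∃ a : ℝ, 0 < a ∧ ∀ (S : Finset W) (hS : S ⊆ R) (hS' : S ⊆ R') (A : Obs G S),
    (ρ' * extendObs hS' A).trace = a • (ρ * extendObs hS A).trace

namespace ReducesTo

variable {ρ : Obs G R} {ρ' : Obs G R'} {ρ'' : Obs G R''}

theorem refl (ρ : Obs G R) : ReducesTo ρ ρ :=
  ⟨subset_rfl, 1, one_pos, fun _ _ _ _ => (one_smul ℝ _).symm⟩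

theorem trans (h : ReducesTo ρ'' ρ') (h' : ReducesTo ρ' ρ) : ReducesTo ρ'' ρ := by
  obtain ⟨hsub, a, ha, htrace⟩ := h
  obtain ⟨hsub', a', ha', htrace'⟩ := h'
  refine ⟨hsub'.trans hsub, a * a', mul_pos ha ha', fun S hS hS'' A => ?_⟩
  rw [htrace S (hS.trans hsub') hS'' A, htrace' S hS _ A, smul_smul]

theorem exists_trace_eq (h : ReducesTo ρ' ρ) :
    ∃ a : ℝ, 0 < a ∧ ρ'.trace = a • ρ.trace ∧
      ∀ (S : Finset W) (hS : S ⊆ R) (hS' : S ⊆ R') (A : Obs G S),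
        (ρ' * extendObs hS' A).trace = a • (ρ * extendObs hS A).trace := by
  obtain ⟨hsub, a, ha, htrace⟩ := h
  refine ⟨a, ha, ?_, htrace⟩
  simpa only [extendObs_one, mul_one] using htrace R subset_rfl hsub 1

theorem trace_ne_zero (h : ReducesTo ρ' ρ) (hρ : ρ.trace ≠ 0) : ρ'.trace ≠ 0 := by
  obtain ⟨a, ha, htrace, -⟩ := h.exists_trace_eq
  exact htrace.trans_ne (smul_ne_zero ha.ne' hρ)

end ReducesTo

/-- The multiple of `ρ` of trace one. -/
def normalize (ρ : Obs G R) : Obs G R :=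
  ρ.trace⁻¹ • ρ

theorem expectation_normalize (ρ : Obs G R) {S : Finset W} (hS : S ⊆ R) (A : Obs G S) :
    expectation G (normalize ρ) A = ρ.trace⁻¹ * (ρ * extendObs hS A).trace := by
  rw [expectation, dif_pos hS, normalize, smul_mul_assoc, Matrix.trace_smul, smul_eq_mul]

theorem ReducesTo.expectation_normalize_eq {ρ : Obs G R} {ρ' : Obs G R'} (h : ReducesTo ρ' ρ)
    {S : Finset W} (hS : S ⊆ R) (A : Obs G S) :
    expectation G (normalize ρ') A = expectation G (normalize ρ) A := by
  obtain ⟨a, ha, htrace_one, htrace⟩ := h.exists_trace_eq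
  rw [expectation_normalize ρ hS, expectation_normalize ρ' (hS.trans h.1), htrace_one,
    htrace S hS, Complex.real_smul, Complex.real_smul, mul_inv_rev, mul_assoc,
    inv_mul_cancel_left₀ (Complex.ofReal_ne_zero.2 ha.ne')]

theorem isGroundState_normalize {ρ : Obs G R} (hρ : ρ.PosSemidef) (hρ_trace : ρ.trace ≠ 0)
    (hHρ : hamiltonian G R * ρ = 0) : IsGroundState G R (normalize ρ) where
  posSemidef := hρ.smul (inv_nonneg.2 hρ.trace_nonneg)
  trace_eq_one := by
    rw [normalize, Matrix.trace_smul, smul_eq_mul, inv_mul_cancel₀ hρ_trace]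
  hamiltonian_mul := by rw [normalize, mul_smul_comm, hHρ, smul_zero]

theorem exists_isInfiniteVolumeGroundState (ρ : ∀ n, Obs G (ball G o n))
    (hball : ∀ R : Finset W, ∃ n, R ⊆ ball G o n) (hρ : ∀ n, (ρ n).PosSemidef)
    (hρ_trace : (ρ 0).trace ≠ 0) (hHρ : ∀ n, hamiltonian G _ * ρ n = 0)
    (hred : ∀ n, ReducesTo (ρ (n + 1)) (ρ n)) :
    ∃ ω : ∀ R : Finset W, Obs G R → ℂ, IsInfiniteVolumeGroundState G o ω ∧
      ∀ A : Obs G (ball G o 0), ω _ A = expectation G (normalize (ρ 0)) A := by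
  have hred_le {n k : ℕ} (hnk : n ≤ k) : ReducesTo (ρ k) (ρ n) := by
    induction k, hnk using Nat.le_induction with
    | base => exact .refl _
    | succ k _ ih => exact (hred k).trans ih
  choose N hN using hball
  refine ⟨fun R A => expectation G (normalize (ρ (N R))) A, ⟨fun n => normalize (ρ n),
    fun n => isGroundState_normalize (hρ n) ((hred_le n.zero_le).trace_ne_zero hρ_trace) (hHρ n),
    fun R A => tendsto_const_nhds.congr' ?_⟩,
    fun A => (hred_le (Nat.zero_le _)).expectation_normalize_eq subset_rfl A⟩
  filter_upwards [eventually_ge_atTop (N R)] with n hn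
  exact ((hred_le hn).expectation_normalize_eq (hN R) A).symm

end Reduction

section BondMixtureReduction

variable {W : Type*} {G : SimpleGraph W} [G.LocallyFinite] {o : W} {par : W → W} {dep : W → ℕ}
  {R : Finset W} {m : W → ℝ}

namespace IsRootedTree

theorem reducesTo_bondMixture_insert (h : IsRootedTree G o par dep) (hR : IsParentClosed o par R)
    (hm : IsBoundaryLaw G o par m) {c : W} (hc : c ∈ legs G o par R) :
    ReducesTo (bondMixture G o par m (insert c R)) (bondMixture G o par m R) := by
  refine ⟨Finset.subset_insert c R, _, card_add_two_mul_legMass_pos (K := children G o par c)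
    fun x _ => hm.abs_le_one x, fun S hS _ A => ?_⟩
  rw [trace_mul_extendObs_insert (h.mem_legs.1 hc).1 hS, h.partialTrace_bondMixture hR hm hc,
    smul_mul_assoc, Matrix.trace_smul]

theorem reducesTo_bondMixture_union (h : IsRootedTree G o par dep) (hR : IsParentClosed o par R)
    (hm : IsBoundaryLaw G o par m) {T : Finset W} (hT : T ⊆ legs G o par R) :
    ReducesTo (bondMixture G o par m (R ∪ T)) (bondMixture G o par m R) := by
  induction T using Finset.induction_on with
  | empty =>
    rw [Finset.union_empty]
    exact .refl _
  | insert c T hcT ih =>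
    rw [Finset.insert_subset_iff] at hT
    obtain ⟨hcR, hco, hcpar⟩ := h.mem_legs.1 hT.1
    have hc : c ∈ legs G o par (R ∪ T) :=
      h.mem_legs.2 ⟨by simp [hcR, hcT], hco, Finset.mem_union_left _ hcpar⟩
    rw [Finset.union_insert]
    exact (h.reducesTo_bondMixture_insert (h.isParentClosed_union hR hT.2) hm hc).trans (ih hT.2)

theorem reducesTo_bondMixture_ball_succ (h : IsRootedTree G o par dep)
    (hm : IsBoundaryLaw G o par m) (n : ℕ) :
    ReducesTo (bondMixture G o par m (ball G o (n + 1))) (bondMixture G o par m (ball G o n)) := by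
  rw [h.ball_succ_eq]
  exact h.reducesTo_bondMixture_union (h.isParentClosed_ball n) hm subset_rfl

end IsRootedTree

end BondMixtureReduction

section Root

open MvPolynomial

variable {W : Type*} {G : SimpleGraph W} [G.LocallyFinite] {o : W} {par : W → W} {dep : W → ℕ}
  {m : W → ℝ}

/-- The root as a site of the ball of radius `0`. -/
abbrev rootSite (o : W) : ({o} : Finset W) :=
  ⟨o, Finset.mem_singleton_self o⟩

theorem polyAmplitude_singleton_X_pow (k : ℕ) (σ : Config G {o}) :
    polyAmplitude {o} (X o ^ k) σ =
      if (σ (rootSite o) : ℕ) = k then √(monomialNormSq (G.degree o) k) else 0 := by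
  have hexponent : configExponent σ = Finsupp.single o (σ (rootSite o) : ℕ) := by
    ext x
    by_cases hx : x = o
    · subst hx
      rw [Finsupp.single_eq_same]
      exact configExponent_coe σ (rootSite x)
    · rw [Finsupp.single_eq_of_ne hx, configExponent_of_notMem _ (by simpa using hx)]
  rw [polyAmplitude, configWeight_eq_prod, Finset.prod_singleton, hexponent, coeff_X_pow,
    Finsupp.single_eq_same]
  simp only [(Finsupp.single_injective o).eq_iff, eq_comm (a := k)]
  split_ifs with hk
  · rw [one_mul, hk]
  · rw [zero_mul]

theorem config_singleton_ext_iff {σ τ : Config G {o}} :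
    σ = τ ↔ σ (rootSite o) = τ (rootSite o) := by
  refine ⟨fun hστ => hστ ▸ rfl, fun hστ => funext fun ⟨x, hx⟩ => ?_⟩
  obtain rfl := Finset.mem_singleton.1 hx
  exact hστ

theorem polyState_singleton_X_pow (σ : Config G {o}) :
    polyState {o} (X o ^ (σ (rootSite o) : ℕ)) =
      Matrix.single σ σ (monomialNormSq (G.degree o) (σ (rootSite o)) : ℂ) := by
  ext τ υ
  rw [polyState_apply, polyAmplitude_singleton_X_pow, polyAmplitude_singleton_X_pow,
    Matrix.single_apply]
  simp only [← Fin.ext_iff, ← config_singleton_ext_iff, eq_comm (a := σ), mul_ite, ite_mul,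
    zero_mul, mul_zero, ← ite_and, Real.mul_self_sqrt (monomialNormSq_pos _ _).le, and_comm]
  split_ifs <;> simp

theorem IsRootedTree.trace_bondMixture_root_mul (h : IsRootedTree G o par dep) (f : ℕ → ℝ)
    {M : Obs G {o}} (hM : ∀ σ, M σ σ = f (σ (rootSite o))) :
    (bondMixture G o par m {o} * M).trace =
      ((spinMean m (children G o par o) fun κ =>
        monomialNormSq (children G o par o).card κ.card * f κ.card : ℝ) : ℂ) := by
  have hlegs : legs G o par {o} = children G o par o := by
    rw [legs, Finset.singleton_biUnion, Finset.sdiff_singleton_eq_erase,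
      Finset.erase_eq_of_notMem (h.notMem_children_self o)]
  have hterm : ∀ κ ⊆ children G o par o,
      (polyState {o} (bondPoly par (({o} : Finset W).erase o) κ) * M).trace =
        ((monomialNormSq (children G o par o).card κ.card * f κ.card : ℝ) : ℂ) := fun κ hκ => by
    have hprod : ∏ e ∈ κ, (X (par e) : MvPolynomial W ℝ) = X o ^ κ.card :=
      Finset.prod_eq_pow_card fun e he => by rw [(h.mem_children.1 (hκ he)).2]
    have hlt : κ.card < G.degree o + 1 := by
      rw [h.degree_root]
      exact Nat.lt_succ_of_le (Finset.card_le_card hκ)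
    let σ : Config G {o} := Function.update 0 (rootSite o) ⟨κ.card, hlt⟩
    have hσ : (σ (rootSite o) : ℕ) = κ.card := by simp [σ]
    rw [bondPoly, Finset.erase_singleton, Finset.prod_empty, one_mul, hprod, ← hσ,
      polyState_singleton_X_pow, Matrix.trace_single_mul, hM, ← h.degree_root]
    push_cast
    rfl
  rw [bondMixture, hlegs, spinMean, spinMean, Finset.sum_mul, Matrix.trace_sum,
    Complex.ofReal_sum]
  refine Finset.sum_congr rfl fun κ hκ => ?_
  rw [smul_mul_assoc, Matrix.trace_smul, hterm κ (Finset.mem_powerset.1 hκ), Complex.real_smul,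
    smul_eq_mul, ← Complex.ofReal_mul]

theorem IsRootedTree.trace_bondMixture_root (h : IsRootedTree G o par dep) :
    (bondMixture G o par m {o}).trace = (legMass m (children G o par o) : ℂ) := by
  have htrace := h.trace_bondMixture_root_mul (m := m) (fun _ => 1) (M := 1) fun σ => by simp
  rw [legMass]
  simpa only [mul_one] using htrace

theorem IsRootedTree.trace_bondMixture_root_mul_spinZ (h : IsRootedTree G o par dep) :
    (bondMixture G o par m {o} * siteObs (rootSite o) (spinZ (G.degree o))).trace =
      (legMoment m (children G o par o) / 2 : ℂ) := by
  have hhalf : (spinMean m (children G o par o) fun κ =>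
      monomialNormSq (children G o par o).card κ.card *
        ((2 * κ.card - (children G o par o).card) / 2)) =
      legMoment m (children G o par o) / 2 := by
    simp only [legMoment, spinMean, smul_eq_mul, Finset.sum_div, mul_div_assoc]
  rw [h.trace_bondMixture_root_mul fun k => (2 * k - (children G o par o).card) / 2, hhalf]
  · push_cast
    rfl
  · intro σ
    simp [siteObs, spinZ, h.degree_root]
    ring

theorem IsRootedTree.exists_isInfiniteVolumeGroundState (h : IsRootedTree G o par dep)
    (hm : IsBoundaryLaw G o par m) :
    ∃ ω : ∀ R : Finset W, Obs G R → ℂ, IsInfiniteVolumeGroundState G o ω ∧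
      ω (ball G o 0) (siteObs (rootSite o) (spinZ (G.degree o))) =
        (((children G o par o).card + 2) / 2 * legResponse m (children G o par o) : ℝ) := by
  have hmass : 0 < legMass m (children G o par o) :=
    zero_lt_one.trans_le (one_le_legMass fun x _ => hm.abs_le_one x)
  obtain ⟨ω, hω, hω_root⟩ := AKLT.exists_isInfiniteVolumeGroundState
    (fun n => bondMixture G o par m (ball G o n))
    (fun R => ⟨R.sup dep, fun x hx => (h.mem_ball _ x).2 (Finset.le_sup (f := dep) hx)⟩)
    (fun n => posSemidef_bondMixture hm.abs_le_one)
    (h.trace_bondMixture_root.trans_ne (Complex.ofReal_ne_zero.2 hmass.ne'))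
    (fun n => h.hamiltonian_mul_bondMixture) (h.reducesTo_bondMixture_ball_succ hm)
  refine ⟨ω, hω, ?_⟩
  have htrace : (bondMixture G o par m (ball G o 0)).trace = legMass m (children G o par o) :=
    h.trace_bondMixture_root
  rw [hω_root, expectation_normalize _ subset_rfl, extendObs_refl, htrace]
  refine (congrArg _ h.trace_bondMixture_root_mul_spinZ).trans ?_
  rw [← mul_legResponse fun x _ => hm.abs_le_one x]
  push_cast
  field_simp

theorem IsRootedTree.not_hasUniqueGroundState_of_isBoundaryLaw (h : IsRootedTree G o par dep)
    (hm : IsBoundaryLaw G o par m) (hroot : legResponse m (children G o par o) ≠ 0) :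
    ¬ HasUniqueGroundState G o := fun hunique => by
  obtain ⟨ω, hω, hω_root⟩ := h.exists_isInfiniteVolumeGroundState hm
  obtain ⟨ω', hω', hω'_root⟩ := h.exists_isInfiniteVolumeGroundState hm.neg
  rw [hunique ω' ω hω' hω, hω_root, Complex.ofReal_inj, legResponse_neg, mul_neg,
    self_eq_neg] at hω'_root
  exact mul_ne_zero (by positivity) hroot hω'_root

-- The antiferromagnetic ground states are staggered.
theorem IsRootedTree.isBoundaryLaw_staggered (h : IsRootedTree G o par dep) {μ : W → ℝ}
    (hμ : ∀ x, |μ x| ≤ 1) (hfix : ∀ x, μ x = legResponse μ (children G o par x)) :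
    IsBoundaryLaw G o par fun x => (-1) ^ dep x * μ x where
  abs_le_one x := by rw [abs_mul, abs_neg_one_pow, one_mul]; exact hμ x
  eq_neg_legResponse c _ := by
    have hchildren : ∀ y ∈ children G o par c,
        (-1) ^ dep y * μ y = -((-1) ^ dep c * μ y) := fun y hy => by
      obtain ⟨hyo, hyc⟩ := h.mem_children.1 hy
      rw [h.dep_par y hyo, hyc, pow_succ]
      ring
    rcases neg_one_pow_eq_or ℝ (dep c) with hsign | hsign <;> simp only [hsign] at hchildren ⊢
    · rw [legResponse_congr (n := -μ) fun y hy => by simp [hchildren y hy], legResponse_neg,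
        ← hfix]
      ring
    · rw [legResponse_congr (n := μ) fun y hy => by simp [hchildren y hy], ← hfix]
      ring

theorem IsRootedTree.not_hasUniqueGroundState (h : IsRootedTree G o par dep) {μ : W → ℝ}
    (hμ : ∀ x, |μ x| ≤ 1) (hfix : ∀ x, μ x = legResponse μ (children G o par x))
    (hroot : μ o ≠ 0) : ¬ HasUniqueGroundState G o := by
  refine h.not_hasUniqueGroundState_of_isBoundaryLaw (h.isBoundaryLaw_staggered hμ hfix) ?_
  have hchildren : ∀ y ∈ children G o par o, (-1) ^ dep y * μ y = (-μ) y := fun y hy => by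
    obtain ⟨hyo, hpar⟩ := h.mem_children.1 hy
    simp [h.dep_par y hyo, hpar, h.dep_root]
  rwa [legResponse_congr hchildren, legResponse_neg, ← hfix, neg_ne_zero]

end Root

/-! ### Magnetisation recursion on a finite tree -/

section FixedPoint

theorem exists_pos_fixedPoint {f : ℝ → ℝ} {c : ℝ} (hf : ContinuousOn f (Set.Icc 0 1))
    (hf_one : f 1 ≤ 1) (hf_zero : f 0 = 0) (hderiv : HasDerivAt f c 0) (hc : 1 < c) :
    ∃ t ∈ Set.Ioc 0 1, f t = t := by
  have hslope : Tendsto (slope f 0) (𝓝[>] 0) (𝓝 c) :=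
    (hasDerivAt_iff_tendsto_slope.1 hderiv).mono_left
      (nhdsWithin_mono _ fun _ hx => (ne_of_gt hx))
  have hunit : ∀ᶠ t in 𝓝[>] (0 : ℝ), t ∈ Set.Ioo (0 : ℝ) 1 := Ioo_mem_nhdsGT zero_lt_one
  obtain ⟨ε, hε, hε_pos, hε_lt⟩ := ((hslope.eventually (lt_mem_nhds hc)).and hunit).exists
  rw [slope_def_field, hf_zero, sub_zero, sub_zero, lt_div_iff₀ hε_pos, one_mul] at hε
  have hcont : ContinuousOn (fun t => f t - t) (Set.Icc ε 1) :=
    (hf.mono (Set.Icc_subset_Icc_left hε_pos.le)).sub continuousOn_id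
  obtain ⟨t, ht, ht_zero⟩ := intermediate_value_Icc' hε_lt.le hcont
    (show (0 : ℝ) ∈ Set.Icc (f 1 - 1) (f ε - ε) from ⟨by linarith, by linarith⟩)
  exact ⟨t, ⟨hε_pos.trans_le ht.1, ht.2⟩, sub_eq_zero.1 ht_zero⟩

end FixedPoint

section FiniteTree

variable {U : Type*} {G : SimpleGraph U} [G.LocallyFinite] {o : U} {par : U → U} {dep : U → ℕ}
  {B : Finset U} {t : ℝ} {f g : U → ℝ}

/-- The function `f` is a solution of the magnetisation recursion with the boundary value `t` on
`B`. -/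
structure SolvesLegRecursion (G : SimpleGraph U) [G.LocallyFinite] (o : U) (par : U → U)
    (B : Finset U) (t : ℝ) (f : U → ℝ) : Prop where
  eq_of_mem : ∀ x ∈ B, f x = t
  eq_of_notMem : ∀ x ∉ B, f x = legResponse f (children G o par x)

namespace IsRootedTree

theorem wellFounded_child [Finite U] (h : IsRootedTree G o par dep) :
    WellFounded fun y x => y ∈ children G o par x := by
  refine Subrelation.wf (r := dep ⁻¹'o (· > ·)) (fun {y x} hy => ?_)
    (Finite.wellFounded_of_trans_of_irrefl _)
  obtain ⟨hyo, rfl⟩ := h.mem_children.1 hy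
  exact (Nat.lt_succ_self _).trans_eq (h.dep_par y hyo).symm

theorem exists_solvesLegRecursion [Finite U] (h : IsRootedTree G o par dep) (B : Finset U)
    (t : ℝ) : ∃ f, SolvesLegRecursion G o par B t f := by
  let f : U → ℝ := h.wellFounded_child.fix fun x rec =>
    if x ∈ B then t else
      legResponse (fun y => if hy : y ∈ children G o par x then rec y hy else 0)
        (children G o par x)
  have hf (x : U) : f x = if x ∈ B then t else
      legResponse (fun y => if y ∈ children G o par x then f y else 0) (children G o par x) := by
    rw [show f x = _ from WellFounded.fix_eq _ _ _]
    rfl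
  refine ⟨f, fun x hx => by rw [hf, if_pos hx], fun x hx => ?_⟩
  rw [hf, if_neg hx]
  exact legResponse_congr fun y hy => if_pos hy

theorem sum_children [Fintype U] (h : IsRootedTree G o par dep) (f : U → ℝ) :
    ∑ x, ∑ y ∈ children G o par x, f y = ∑ y ∈ Finset.univ.erase o, f y := by
  rw [← Finset.sum_fiberwise (Finset.univ.erase o) par f]
  refine Finset.sum_congr rfl fun x _ => Finset.sum_congr ?_ fun _ _ => rfl
  ext y
  simp [h.mem_children]

theorem root_eq_sum_pow [Fintype U] (h : IsRootedTree G o par dep) {a : ℝ} {s L : U → ℝ}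
    (hL : ∀ x, L x = s x + a * ∑ y ∈ children G o par x, L y) :
    L o = ∑ x, a ^ dep x * s x := by
  have hchild : ∀ x, ∀ y ∈ children G o par x, a ^ dep x * (a * L y) = a ^ dep y * L y :=
      fun x y hy => by
    obtain ⟨hyo, hyx⟩ := h.mem_children.1 hy
    rw [h.dep_par y hyo, hyx, pow_succ, mul_assoc]
  have hsum : ∑ x, a ^ dep x * L x =
      ∑ x, a ^ dep x * s x + ∑ y ∈ Finset.univ.erase o, a ^ dep y * L y := by
    rw [← h.sum_children, ← Finset.sum_add_distrib]
    refine Finset.sum_congr rfl fun x _ => ?_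
    rw [← Finset.sum_congr rfl (hchild x), ← Finset.mul_sum, ← Finset.mul_sum, ← mul_add, ← hL]
  rw [← Finset.add_sum_erase _ _ (Finset.mem_univ o), h.dep_root, pow_zero, one_mul] at hsum
  exact add_right_cancel hsum

end IsRootedTree

namespace SolvesLegRecursion

variable [Finite U]

theorem abs_le_one (hf : SolvesLegRecursion G o par B t f) (h : IsRootedTree G o par dep)
    (ht : |t| ≤ 1) (x : U) : |f x| ≤ 1 := by
  induction x using h.wellFounded_child.induction with
  | _ x ih =>
    by_cases hx : x ∈ B
    · rwa [hf.eq_of_mem x hx]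
    · rw [hf.eq_of_notMem x hx]
      exact abs_legResponse_le_one ih

theorem eq_zero (hf : SolvesLegRecursion G o par B 0 f) (h : IsRootedTree G o par dep) (x : U) :
    f x = 0 := by
  induction x using h.wellFounded_child.induction with
  | _ x ih =>
    by_cases hx : x ∈ B
    · exact hf.eq_of_mem x hx
    · rw [hf.eq_of_notMem x hx, legResponse_congr (n := 0) ih, legResponse_zero]

variable {F : ℝ → U → ℝ}

theorem continuousOn (hF : ∀ t, SolvesLegRecursion G o par B t (F t))
    (h : IsRootedTree G o par dep) (x : U) :
    ContinuousOn (fun t => F t x) (Set.Icc 0 1) := by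
  induction x using h.wellFounded_child.induction with
  | _ x ih =>
    by_cases hx : x ∈ B
    · simpa only [(hF _).eq_of_mem x hx] using continuousOn_id' (Set.Icc (0 : ℝ) 1)
    · simp only [fun t => (hF t).eq_of_notMem x hx]
      exact continuousOn_legResponse ih fun t ht y _ =>
        (hF t).abs_le_one h (abs_le.2 ⟨by linarith [ht.1], ht.2⟩) y

theorem hasDerivAt_of_notMem (hF : ∀ t, SolvesLegRecursion G o par B t (F t))
    (h : IsRootedTree G o par dep) {x : U} (hx : x ∉ B)
    (hdiff : ∀ y ∈ children G o par x, DifferentiableAt ℝ (fun t => F t y) 0) :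
    HasDerivAt (fun t => F t x) (1 / 3 * ∑ y ∈ children G o par x, deriv (fun t => F t y) 0) 0 := by
  simp only [fun t => (hF t).eq_of_notMem x hx]
  exact hasDerivAt_legResponse (fun y hy => (hdiff y hy).hasDerivAt) fun y _ => (hF 0).eq_zero h y

theorem differentiableAt (hF : ∀ t, SolvesLegRecursion G o par B t (F t))
    (h : IsRootedTree G o par dep) (x : U) : DifferentiableAt ℝ (fun t => F t x) 0 := by
  induction x using h.wellFounded_child.induction with
  | _ x ih =>
    by_cases hx : x ∈ B
    · simpa only [(hF _).eq_of_mem x hx] using differentiableAt_fun_id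
    · exact (hasDerivAt_of_notMem hF h hx ih).differentiableAt

theorem hasDerivAt_root (hF : ∀ t, SolvesLegRecursion G o par B t (F t))
    (h : IsRootedTree G o par dep) (hB : ∀ x ∈ B, children G o par x = ∅) :
    HasDerivAt (fun t => F t o) (∑ x ∈ B, (1 / 3) ^ dep x) 0 := by
  cases nonempty_fintype U
  refine (differentiableAt hF h o).hasDerivAt.congr_deriv ?_
  rw [h.root_eq_sum_pow (a := 1 / 3) (s := fun x => if x ∈ B then 1 else 0)
    (L := fun x => deriv (fun t => F t x) 0)]
  · simp
  intro x
  by_cases hx : x ∈ B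
  · simp [hB x hx, hx, (hF _).eq_of_mem x hx]
  · rw [if_neg hx, zero_add]
    exact (hasDerivAt_of_notMem hF h hx fun y _ => differentiableAt hF h y).deriv

end SolvesLegRecursion

theorem IsRootedTree.exists_solvesLegRecursion_root [Finite U] (h : IsRootedTree G o par dep)
    (hB : ∀ x ∈ B, children G o par x = ∅) (hsum : 1 < ∑ x ∈ B, (1 / 3 : ℝ) ^ dep x) :
    ∃ f, SolvesLegRecursion G o par B (f o) f ∧ (∀ x, |f x| ≤ 1) ∧ f o ≠ 0 := by
  choose F hF using h.exists_solvesLegRecursion B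
  obtain ⟨t, ⟨ht_pos, ht_le⟩, ht⟩ := exists_pos_fixedPoint
    (SolvesLegRecursion.continuousOn hF h o)
    (abs_le.1 ((hF 1).abs_le_one h abs_one.le o)).2 ((hF 0).eq_zero h o)
    (SolvesLegRecursion.hasDerivAt_root hF h hB) hsum
  refine ⟨F t, by rw [ht]; exact hF t, (hF t).abs_le_one h ?_, by rw [ht]; exact ht_pos.ne'⟩
  rwa [abs_of_pos ht_pos]

end FiniteTree

/-! ### Paths in a rooted tree -/

section Paths

variable {U : Type*} {G : SimpleGraph U} {o x y : U} {par : U → U} {dep : U → ℕ}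

namespace IsRootedTree

-- A path which starts with a step away from the root has to return through its starting point.
theorem eq_par_of_isPath_cons (h : IsRootedTree G o par dep) {hadj : G.Adj x y} {p : G.Walk y o}
    (hp : (p.cons hadj).IsPath) : x ≠ o ∧ y = par x := by
  induction p generalizing x with
  | nil =>
    rcases (h.adj_iff _ _).1 hadj with ⟨hx, hpar⟩ | ⟨hy, -⟩
    · exact ⟨hx, hpar.symm⟩
    · exact absurd rfl hy
  | @cons y z o hadj' p ih =>
    obtain ⟨hp_tail, hx⟩ := SimpleGraph.Walk.cons_isPath_iff _ _ |>.1 hp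
    refine ⟨ne_of_mem_of_not_mem (SimpleGraph.Walk.end_mem_support _) hx |>.symm, ?_⟩
    rcases (h.adj_iff x y).1 hadj with ⟨-, hpar⟩ | ⟨-, hpar⟩
    · exact hpar.symm
    · refine absurd ?_ hx
      rw [← hpar, ← (ih h hp_tail).2]
      exact List.mem_cons_of_mem _ p.start_mem_support

theorem length_eq_dep (h : IsRootedTree G o par dep) {p : G.Walk x o} (hp : p.IsPath) :
    p.length = dep x := by
  induction p with
  | nil => exact h.dep_root.symm
  | cons hadj p ih =>
    obtain ⟨hx, rfl⟩ := h.eq_par_of_isPath_cons hp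
    rw [SimpleGraph.Walk.length_cons, ih h hp.of_cons, ← h.dep_par _ hx]

theorem isPath_unique (h : IsRootedTree G o par dep) {p q : G.Walk x o} (hp : p.IsPath)
    (hq : q.IsPath) : p = q := by
  induction p with
  | nil => exact (SimpleGraph.Walk.isPath_iff_nil.1 hq).eq_nil.symm
  | cons hadj p ih =>
    obtain ⟨hx, rfl⟩ := h.eq_par_of_isPath_cons hp
    cases q with
    | nil => exact absurd rfl hx
    | cons hadj' q =>
      obtain ⟨-, rfl⟩ := h.eq_par_of_isPath_cons hq
      rw [ih h hp.of_cons hq.of_cons]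

theorem reachable_root (h : IsRootedTree G o par dep) (x : U) : G.Reachable x o := by
  induction hn : dep x generalizing x with
  | zero => rw [h.eq_root_of_dep_eq_zero hn]
  | succ n ih =>
    have hx : x ≠ o := fun hxo => by simp [hxo, h.dep_root] at hn
    exact (h.adj_par hx).reachable.trans (ih (par x) (by have := h.dep_par x hx; omega))

theorem finsum_path_pow_length (h : IsRootedTree G o par dep) (a : ℝ) (x : U) :
    ∑ᶠ γ : G.Path o x, a ^ γ.1.length = a ^ dep x := by
  obtain ⟨p, hp⟩ := (h.reachable_root x).exists_isPath
  have hlength (γ : G.Path o x) : γ.1.length = dep x := by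
    rw [← h.length_eq_dep γ.2.reverse, SimpleGraph.Walk.length_reverse]
  have hunique (γ : G.Path o x) : γ = ⟨p.reverse, hp.reverse⟩ :=
    Subtype.ext (SimpleGraph.Walk.reverse_injective <| by
      rw [SimpleGraph.Walk.reverse_reverse, h.isPath_unique γ.2.reverse hp])
  rw [finsum_eq_single _ ⟨p.reverse, hp.reverse⟩ fun γ hγ => absurd (hunique γ) hγ, hlength]

end IsRootedTree

theorem exists_isRootedTree (hG : G.IsTree) (o : U) :
    ∃ par dep, IsRootedTree G o par dep := by
  choose p hp using fun x => (hG.existsUnique_path o x).exists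
  have hstep {x y : U} (hadj : G.Adj x y) (hx : x ∈ (p y).support) : p y = (p x).concat hadj :=
    hG.2.path_concat (hp x) (hp y) hadj hx
  have hpen {x : U} (hx : x ≠ o) : G.Adj (p x).penultimate x :=
    (p x).adj_penultimate (SimpleGraph.Walk.not_nil_of_ne hx.symm)
  have hroot : p o = .nil := (SimpleGraph.Walk.isPath_iff_nil.1 (hp o)).eq_nil
  have hpar {x y : U} (hadj : G.Adj x y) (hx : x ∈ (p y).support) :
      y ≠ o ∧ (p y).penultimate = x := by
    refine ⟨?_, by rw [hstep hadj hx, SimpleGraph.Walk.penultimate_concat]⟩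
    rintro rfl
    rw [hroot, SimpleGraph.Walk.support_nil, List.mem_singleton] at hx
    exact hadj.ne hx
  refine ⟨fun x => (p x).penultimate, fun x => (p x).length, ?_, fun x hx => ?_, fun x y =>
    ⟨fun hadj => ?_, ?_⟩⟩
  · rw [hroot, SimpleGraph.Walk.length_nil]
  · have := congrArg SimpleGraph.Walk.length
      (hstep (hpen hx) (SimpleGraph.Walk.getVert_mem_support _ _))
    rwa [SimpleGraph.Walk.length_concat] at this
  · by_cases hx : x ∈ (p y).support
    · exact Or.inr (hpar hadj hx)
    · exact Or.inl (hpar hadj.symm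
        (hG.2.mem_support_of_ne_mem_support_of_adj_of_isPath (hp x) (hp y) hadj hx))
  · rintro (⟨hx, rfl⟩ | ⟨hy, rfl⟩)
    · exact (hpen hx).symm
    · exact hpen hy

end Paths

end

end AKLT

/-! ### The parent map of a quasi-Cayley tree -/

namespace QuasiCayley

noncomputable section

open AKLT

variable {V ι : Type*}

section RootedTree

variable {Λ : SimpleGraph V} {r : V} {par : V → V} {dep : V → ℕ}

/-- The parent map of the augmentation, where `par` is the parent map of the cell: the parent of the
new vertex `v_k` is the boundary point `b k`. -/
abbrev augmentationPar (b : ι → V) (par : V → V) : V ⊕ ι → V ⊕ ι :=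
  Sum.elim (.inl ∘ par) (.inl ∘ b)

theorem isRootedTree_augmentation (h : IsRootedTree Λ r par dep) (b : ι → V) :
    IsRootedTree (augmentation Λ b) (.inl r) (augmentationPar b par)
      (Sum.elim dep fun k => dep (b k) + 1) where
  dep_root := h.dep_root
  dep_par := by
    rintro (x | k) hx
    · exact h.dep_par x fun hxr => hx (congrArg _ hxr)
    · rfl
  adj_iff := by
    rintro (x | k) (y | l)
    · simpa [augmentation] using h.adj_iff x y
    all_goals simp [augmentation, eq_comm]

theorem pathSum_eq [Fintype ι] (h : IsRootedTree Λ r par dep) (b : ι → V) :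
    pathSum Λ r b = ∑ k, (1 / 3 : ℝ) ^ (dep (b k) + 1) :=
  Finset.sum_congr rfl fun k _ =>
    (isRootedTree_augmentation h b).finsum_path_pow_length (1 / 3) (.inr k)

open scoped Classical in
/-- The parent map of the quasi-Cayley tree, where `par` is the parent map of the cell. -/
def treePar (r : V) (b : ι → V) (par : V → V) : List ι × V → List ι × V
  | ([], x) => ([], par x)
  | (k :: w, x) => if x = r then (w, b k) else (k :: w, par x)

/-- The depth in the quasi-Cayley tree of the root of the copy of the cell with index `w`. -/
def copyDep (b : ι → V) (dep : V → ℕ) : List ι → ℕ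
  | [] => 0
  | k :: w => copyDep b dep w + dep (b k) + 1

theorem treePar_of_ne_root (b : ι → V) (par : V → V) (w : List ι) {x : V} (hx : x ≠ r) :
    treePar r b par (w, x) = (w, par x) := by
  cases w with
  | nil => rfl
  | cons k w => exact if_neg hx

theorem treePar_cons_root (r : V) (b : ι → V) (par : V → V) (k : ι) (w : List ι) :
    treePar r b par (k :: w, r) = (w, b k) :=
  if_pos rfl

theorem eq_mk_or_eq_cons_root {p : List ι × V} (hp : p ≠ ([], r)) :
    (∃ w x, x ≠ r ∧ p = (w, x)) ∨ ∃ k w, p = (k :: w, r) := by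
  obtain ⟨w, x⟩ := p
  by_cases hx : x = r
  · subst hx
    cases w with
    | nil => exact absurd rfl hp
    | cons k w => exact Or.inr ⟨k, w, rfl⟩
  · exact Or.inl ⟨w, x, hx, rfl⟩

theorem adj_treePar (h : IsRootedTree Λ r par dep) (b : ι → V) {p : List ι × V}
    (hp : p ≠ ([], r)) : (graph Λ r b).Adj p (treePar r b par p) := by
  rcases eq_mk_or_eq_cons_root hp with ⟨w, x, hx, rfl⟩ | ⟨k, w, rfl⟩
  · rw [treePar_of_ne_root b par w hx]
    exact Or.inl ⟨rfl, h.adj_par hx⟩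
  · rw [treePar_cons_root]
    exact Or.inr (Or.inr ⟨k, rfl, rfl, rfl⟩)

theorem treePar_eq_of_adj (h : IsRootedTree Λ r par dep) (b : ι → V) {p q : List ι × V}
    (hadj : (graph Λ r b).Adj p q) :
    p ≠ ([], r) ∧ treePar r b par p = q ∨ q ≠ ([], r) ∧ treePar r b par q = p := by
  obtain ⟨w, x⟩ := p
  obtain ⟨w', x'⟩ := q
  rcases hadj with ⟨hw : w = w', hadj⟩ | ⟨k, rfl, rfl, rfl⟩ | ⟨k, rfl, rfl, rfl⟩
  · subst hw
    rcases (h.adj_iff x x').1 hadj with ⟨hx, rfl⟩ | ⟨hx, rfl⟩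
    · exact Or.inl ⟨fun hp => hx (congrArg Prod.snd hp), treePar_of_ne_root b par w hx⟩
    · exact Or.inr ⟨fun hp => hx (congrArg Prod.snd hp), treePar_of_ne_root b par w hx⟩
  · exact Or.inr ⟨by simp, treePar_cons_root _ b par k w⟩
  · exact Or.inl ⟨by simp, treePar_cons_root _ b par k w'⟩

theorem isRootedTree_graph (h : IsRootedTree Λ r par dep) (b : ι → V) :
    IsRootedTree (graph Λ r b) ([], r) (treePar r b par)
      (fun p => copyDep b dep p.1 + dep p.2) where
  dep_root := (Nat.zero_add _).trans h.dep_root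
  dep_par p hp := by
    rcases eq_mk_or_eq_cons_root hp with ⟨w, x, hx, rfl⟩ | ⟨k, w, rfl⟩
    · rw [treePar_of_ne_root b par w hx]
      exact congrArg (copyDep b dep w + ·) (h.dep_par x hx)
    · simp only [treePar_cons_root, copyDep, h.dep_root, add_zero]
  adj_iff p q := by
    refine ⟨treePar_eq_of_adj h b, ?_⟩
    rintro (⟨hp, rfl⟩ | ⟨hq, rfl⟩)
    · exact adj_treePar h b hp
    · exact (adj_treePar h b hq).symm

/-- The inclusion of the copy with index `w` of the augmented cell into the quasi-Cayley tree: the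
new vertex `v_k` is identified with the root of the copy `k :: w`. -/
def copyEmbedding (r : V) (w : List ι) : V ⊕ ι ↪ List ι × V where
  toFun := Sum.elim (fun y => (w, y)) fun k => (k :: w, r)
  inj' := by rintro (y | k) (z | l) <;> simp

theorem mem_map_copyEmbedding {K : Finset (V ⊕ ι)} {w : List ι} {q : List ι × V} :
    q ∈ K.map (copyEmbedding r w) ↔
      (∃ y, .inl y ∈ K ∧ (w, y) = q) ∨ ∃ k, .inr k ∈ K ∧ (k :: w, r) = q := by
  simp only [Finset.mem_map, Sum.exists]
  rfl

instance [Finite V] [Finite ι] (Λ : SimpleGraph V) (b : ι → V) :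
    (augmentation Λ b).LocallyFinite :=
  fun _ => Fintype.ofFinite _

theorem children_graph [Finite V] [Finite ι] (h : IsRootedTree Λ r par dep) (b : ι → V)
    (w : List ι) (x : V) :
    children (graph Λ r b) ([], r) (treePar r b par) (w, x) =
      (children (augmentation Λ b) (.inl r) (augmentationPar b par) (.inl x)).map
        (copyEmbedding r w) := by
  ext q
  simp only [mem_map_copyEmbedding, (isRootedTree_graph h b).mem_children,
    (isRootedTree_augmentation h b).mem_children, Sum.elim_inl, Sum.elim_inr, Function.comp_apply,
    ne_eq, Sum.inl.injEq, reduceCtorEq, not_false_eq_true, true_and]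
  constructor
  · rintro ⟨hq, hpar⟩
    rcases eq_mk_or_eq_cons_root hq with ⟨w', y, hy, rfl⟩ | ⟨k, w', rfl⟩
    · rw [treePar_of_ne_root b par w' hy] at hpar
      obtain ⟨rfl, rfl⟩ := Prod.mk.inj hpar
      exact Or.inl ⟨y, ⟨hy, rfl⟩, rfl⟩
    · rw [treePar_cons_root] at hpar
      obtain ⟨rfl, rfl⟩ := Prod.mk.inj hpar
      exact Or.inr ⟨k, rfl, rfl⟩
  · rintro (⟨y, ⟨hy, rfl⟩, rfl⟩ | ⟨k, rfl, rfl⟩)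
    · exact ⟨fun hq => hy (congrArg Prod.snd hq), treePar_of_ne_root b par w hy⟩
    · exact ⟨by simp, treePar_cons_root r b par k w⟩

theorem children_augmentation_inr [Finite V] [Finite ι] (h : IsRootedTree Λ r par dep) (b : ι → V)
    (k : ι) :
    children (augmentation Λ b) (.inl r) (augmentationPar b par) (.inr k) = ∅ := by
  ext (y | l) <;> simp [(isRootedTree_augmentation h b).mem_children]

theorem exists_solvesLegRecursion_augmentation [Finite V] [Fintype ι] {b : ι → V}
    (h : IsRootedTree Λ r par dep) (hsum : 1 < pathSum Λ r b) :
    ∃ f : V ⊕ ι → ℝ, SolvesLegRecursion (augmentation Λ b) (.inl r)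
      (augmentationPar b par) (Finset.univ.map .inr) (f (.inl r)) f ∧
      (∀ x, |f x| ≤ 1) ∧ f (.inl r) ≠ 0 := by
  refine (isRootedTree_augmentation h b).exists_solvesLegRecursion_root ?_ ?_
  · rintro x hx
    obtain ⟨k, -, rfl⟩ := Finset.mem_map.1 hx
    exact children_augmentation_inr h b k
  · rw [Finset.sum_map]
    exact hsum.trans_eq (pathSum_eq h b)

theorem comp_copyEmbedding_of_solvesLegRecursion [Finite V] [Fintype ι] {b : ι → V}
    {f : V ⊕ ι → ℝ} (hf : SolvesLegRecursion (augmentation Λ b) (.inl r)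
      (augmentationPar b par) (Finset.univ.map .inr) (f (.inl r)) f) (w : List ι) :
    (fun p : List ι × V => f (.inl p.2)) ∘ copyEmbedding r w = f := by
  ext (y | k)
  · rfl
  · exact (hf.eq_of_mem (.inr k) (Finset.mem_map_of_mem _ (Finset.mem_univ k))).symm

theorem eq_legResponse_children_graph [Finite V] [Fintype ι] {b : ι → V} {f : V ⊕ ι → ℝ}
    (h : IsRootedTree Λ r par dep) (hf : SolvesLegRecursion (augmentation Λ b) (.inl r)
      (augmentationPar b par) (Finset.univ.map .inr) (f (.inl r)) f)
    (p : List ι × V) :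
    f (.inl p.2) = legResponse (fun p => f (.inl p.2))
      (children (graph Λ r b) ([], r) (treePar r b par) p) := by
  obtain ⟨w, x⟩ := p
  rw [children_graph h, legResponse_map, comp_copyEmbedding_of_solvesLegRecursion hf w,
    ← hf.eq_of_notMem (.inl x) (by simp)]

end RootedTree

end

end QuasiCayley

theorem mainTheorem5 {V ι : Type*} [Fintype V] [Fintype ι]
    (Λ : SimpleGraph V) (hΛ : Λ.IsTree) (r : V) (b : ι → V)
    (hsum : 1 < QuasiCayley.pathSum Λ r b) :
    ¬ AKLT.HasUniqueGroundState (QuasiCayley.graph Λ r b) ([], r) := by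
  obtain ⟨par, dep, h⟩ := AKLT.exists_isRootedTree hΛ r
  obtain ⟨f, hf, hf_le, hf_root⟩ := QuasiCayley.exists_solvesLegRecursion_augmentation h hsum
  exact (QuasiCayley.isRootedTree_graph h b).not_hasUniqueGroundState
    (μ := fun p => f (.inl p.2)) (fun p => hf_le (.inl p.2))
    (QuasiCayley.eq_legResponse_children_graph h hf) hf_root
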